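/- Let $G=(V,E)$ be a finite simple graph, let $\prec$ be an arbitrary total order on $V$, and let $p\colon V\to\mathbb{Z}_{>0}$. For $v\in V$ put $\bar N^-(v)=\{u\in V: u\prec v,\ \{u,v\}\notin E\}$ and $\bar N^+(v)=\{u\in V: v\prec u,\ \{u,v\}\notin E\}$, and let $S=\{v\in V:\bar N^-(v)=\emptyset\}$. Consider a real variable $y$, a variable $x_{uv}$ for each $v\in V$ and $u\in\bar N^-(v)$, and a variable $x_{vv}$ for each $v\in V\setminus S$; put $\gamma_v=1$ if $v\in S$ and $\gamma_v=x_{vv}$ if $v\in V\setminus S$. Let $\mathcal{K}(v)$ be the collection of all sets $K\subseteq\bar N^+(v)$ that induce a clique of size $2$, or a maximal clique of size $1$, in $G[\bar N^+(v)]$. Let $\mathcal{P}(G,p)$ be the convex hull of all $(y,x)$ with $y\ge 0$, all entries of $x$ in $\{0,1\}$, and - $\sum_{u\in\bar N^-(v)\cup\{v\}}x_{uv}\ge 1$ for all $v\in V\setminus S$, - $\sum_{u\in K}x_{vu}\le\gamma_v$ for all $v\in V$ and $K\in\mathcal{K}(v)$, - $p(v)\gamma_v+\sum_{u\in\bar N^+(v)}p(u)x_{vu}\le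 y$ for all $v\in V$. For integers $\ell\ge 2$ and $q\ge 2\ell$, the web $W^q_\ell$ is the graph with vertices $v_0,\dots,v_{q-1}$ in which $v_i$ and $v_j$ are adjacent if and only if $\ell\le|i-j|\le q-\ell$; the antiweb $\bar W^q_\ell$ is its complement. A graph $H$ is $\chi$-critical if $\chi(H-v)<\chi(H)$ for every vertex $v$ of $H$. **Theorem.** Let $U\subseteq V$ and $S_U=\{v\in U:\bar N^-(v)\cap U=\emptyset\}$. If $G[U]$ is $\chi$-critical and is (isomorphic to) a web or an antiweb, then the inequality $$\sum_{v\in U\setminus S_U}\ \sum_{u\in(\bar N^-(v)\setminus U)\cup\{v\}}x_{uv}\ \ge\ \chi(G[U])-|S_U|$$ defines a facet of $\mathcal{P}(G,p)$; that is, it is valid for $\mathcal{P}(G,p)$, and the set of points of $\mathcal{P}(G,p)$ satisfying it with equality is nonempty and has dimension $\dim\mathcal{P}(G,p)-1$. -/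

import Mathlib

/-- The web on the vertices `0, …, q - 1`: `i` and `j` are adjacent iff `l ≤ |i - j| ≤ q - l`.
For `l ≥ 1` the clause `i ≠ j` is redundant. -/
def webGraph (q l : ℕ) : SimpleGraph (Fin q) where
  Adj i j := i ≠ j ∧ (l : ℤ) ≤ |(i : ℤ) - (j : ℤ)| ∧ |(i : ℤ) - (j : ℤ)| ≤ (q : ℤ) - (l : ℤ)
  symm := ⟨fun i j h => ⟨h.1.symm, by rw [abs_sub_comm]; exact h.2⟩⟩
  loopless := ⟨fun _ h => h.1 rfl⟩

/-- `H` is (isomorphic to) a web. -/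
def IsWeb {W : Type*} (H : SimpleGraph W) : Prop :=
  ∃ q l : ℕ, 2 ≤ l ∧ 2 * l ≤ q ∧ Nonempty (H ≃g webGraph q l)

/-- `H` is (isomorphic to) an antiweb, the complement of a web. -/
def IsAntiweb {W : Type*} (H : SimpleGraph W) : Prop :=
  ∃ q l : ℕ, 2 ≤ l ∧ 2 * l ≤ q ∧ Nonempty (H ≃g (webGraph q l)ᶜ)

/-- `χ(H - v) < χ(H)` for every vertex `v`. -/
def IsChiCritical {W : Type*} (H : SimpleGraph W) : Prop :=
  ∀ v : W, (H.induce ({v}ᶜ : Set W)).chromaticNumber < H.chromaticNumber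

/-- The inequality `f z ≥ b` defines a facet of `P`: it is valid for `P`, and the face
`{z ∈ P | f z = b}` is nonempty and has dimension `dim P - 1`. -/
def IsFacetDefining {E : Type*} [AddCommGroup E] [Module ℝ E]
    (P : Set E) (f : E →ₗ[ℝ] ℝ) (b : ℝ) : Prop :=
  (∀ z ∈ P, b ≤ f z) ∧
  {z | z ∈ P ∧ f z = b}.Nonempty ∧
  Module.finrank ℝ (affineSpan ℝ {z | z ∈ P ∧ f z = b}).direction + 1 =
    Module.finrank ℝ (affineSpan ℝ P).direction

namespace RepForm

variable {V : Type*} [Fintype V] [LinearOrder V]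

open Classical in
/-- The negative anti-neighbourhood: the earlier vertices not adjacent to `v`. -/
noncomputable def antiNeg (G : SimpleGraph V) (v : V) : Finset V :=
  Finset.univ.filter fun u => u < v ∧ ¬ G.Adj u v

open Classical in
/-- The positive anti-neighbourhood: the later vertices not adjacent to `v`. -/
noncomputable def antiPos (G : SimpleGraph V) (v : V) : Finset V :=
  Finset.univ.filter fun u => v < u ∧ ¬ G.Adj u v

/-- A source is a vertex with empty negative anti-neighbourhood. -/
def IsSource (G : SimpleGraph V) (v : V) : Prop :=
  antiNeg G v = ∅

open Classical in
/-- The sources `S_U` of the order restricted to `U`. -/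
noncomputable def sourcesIn (G : SimpleGraph V) (U : Finset V) : Finset V :=
  U.filter fun v => antiNeg G v ∩ U = ∅

/-- The index set of the variables `x_{uv}`: pairs `(u, v)` with `u ∈ antiNeg G v`, and pairs
`(v, v)` with `v` not a source. -/
abbrev Var (G : SimpleGraph V) : Type _ :=
  {e : V × V // e.1 ∈ antiNeg G e.2 ∨ (e.1 = e.2 ∧ ¬ IsSource G e.2)}

open Classical in
/-- The coordinate functional `x ↦ x_{uv}` (zero if there is no such variable). -/
noncomputable def coord (G : SimpleGraph V) (u v : V) : (Var G → ℝ) →ₗ[ℝ] ℝ :=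
  if h : u ∈ antiNeg G v ∨ (u = v ∧ ¬ IsSource G v) then
    LinearMap.proj (⟨(u, v), h⟩ : Var G)
  else 0

open Classical in
/-- `x_{vv}` if `v` is not a source, and the constant `1` replacing it if `v` is a source. -/
noncomputable def repVal (G : SimpleGraph V) (x : Var G → ℝ) (v : V) : ℝ :=
  if IsSource G v then 1 else coord G v v x

/-- The sets of vertices of `antiPos G v` that induce a clique of size two, or a maximal
clique of size one, of the subgraph induced by `antiPos G v`. -/
def cliqueFamily (G : SimpleGraph V) (v : V) : Set (Finset V) :=
  {K | K ⊆ antiPos G v ∧ G.IsClique (K : Set V) ∧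
    (K.card = 2 ∨ (K.card = 1 ∧
      ∀ K' : Finset V, K' ⊆ antiPos G v → G.IsClique (K' : Set V) → K ⊆ K' → K' = K))}

/-- The mixed-integer points `(y, x)` of the representatives formulation without the bound on
the number of machines. -/
def feasiblePoints (G : SimpleGraph V) (p : V → ℕ) : Set (ℝ × (Var G → ℝ)) :=
  {z | 0 ≤ z.1 ∧ (∀ e : Var G, z.2 e = 0 ∨ z.2 e = 1) ∧
    (∀ v : V, ¬ IsSource G v → 1 ≤ ∑ u ∈ insert v (antiNeg G v), coord G u v z.2) ∧
    (∀ v : V, ∀ K ∈ cliqueFamily G v, ∑ u ∈ K, coord G v u z.2 ≤ repVal G z.2 v) ∧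
    (∀ v : V, (p v : ℝ) * repVal G z.2 v + ∑ u ∈ antiPos G v, (p u : ℝ) * coord G v u z.2 ≤ z.1)}

/-- The polyhedron `P(G, p)`. -/
def polytope (G : SimpleGraph V) (p : V → ℕ) : Set (ℝ × (Var G → ℝ)) :=
  convexHull ℝ (feasiblePoints G p)

/-- The left-hand side of the subgraph-induced inequality, a linear functional of `(y, x)`. -/
noncomputable def internalLHS (G : SimpleGraph V) (U : Finset V) :
    (ℝ × (Var G → ℝ)) →ₗ[ℝ] ℝ :=
  ∑ v ∈ U \ sourcesIn G U, ∑ u ∈ insert v (antiNeg G v \ U),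
    (coord G u v).comp (LinearMap.snd ℝ ℝ (Var G → ℝ))

end RepForm

/-! Validity: at a feasible 0/1 point, the sources of `U` together with the vertices of `U` that
contribute to the left-hand side can serve as the colours of a proper colouring of `G[U]`.

For the facet property, let `φ` be the quotient map by the direction of the face, so that `φ` is
constant on tight feasible points; it suffices to show that `φ` is a multiple of the left-hand side.
Take `y` at least the total processing time, which makes every load constraint harmless. Colour `U`
optimally and make every vertex outside `U` a class of its own: this gives a tight point. By
criticality any prescribed vertex of `U` can also be a singleton class. Raising `y`, covering a
vertex twice, or moving a singleton `v` into the class of a singleton `u` shows that `φ` kills `y`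
and every variable absent from the inequality, and that `x_{uv}` and `x_{vv}` have equal images when
`v` is in `U \ S_U` and `u` is outside `U`. It remains to prove that the images `g v` of `x_{vv}`
agree for all `v` in `U \ S_U`.

Evaluating `φ` at the tight colourings shows that the sum of `g` over the class minima is the same
for every proper `n`-colouring of `G[U]` (`functional_isClassMinSum`). A critical web or antiweb
with `n = m + 1` has exactly `α * m + 1` vertices, arranged on a cycle so that any `α` consecutive
ones are stable (`IsChiCritical.exists_arrangement`), so every partition of the cycle into `m + 1`
intervals of length at most `α` is a colouring. Two adjacent intervals covering `α + 1` or `α + 2`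
positions may be recut freely. One of the two minima is always the minimum of the union, so the
value of `g` at the other depends on the union alone. Sliding this window around the cycle
propagates that second value, and every vertex with a smaller one at distance less than `α` is found
to have the same `g` (`CutInvariant.eq_of_not_local_min`). A non-source that is a local minimum on
the cycle is compared with such a vertex by moving an earlier non-neighbour into its singleton class
(`exists_not_local_min`). -/

/-- `i` is a position in `[s, e]` at which `f` is minimal. -/
def IsArgMin {V : Type*} [LinearOrder V] (f : ℤ → V) (s e i : ℤ) : Prop :=
  s ≤ i ∧ i ≤ e ∧ ∀ j, s ≤ j → j ≤ e → f i ≤ f j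

/-- `x` is the value of `G` at the minimum of that part of the interval `[s, e]`, cut into two
parts of length at most `α`, which does not contain the minimum of `[s, e]`. -/
def IsSecondVal {V A : Type*} [LinearOrder V] (f : ℤ → V) (G : ℤ → A) (α s e : ℤ) (x : A) : Prop :=
  ∃ a c k, IsArgMin f s e a ∧ (s ≤ c ∧ c < e ∧ c - s < α ∧ e - c ≤ α) ∧
    ((a ≤ c ∧ IsArgMin f (c + 1) e k) ∨ (c < a ∧ IsArgMin f s c k)) ∧ x = G k

/-- The sum of the values of `G` at the minima of the two parts does not depend on the cut. -/
def CutInvariant {V A : Type*} [LinearOrder V] [AddCommGroup A] (f : ℤ → V) (G : ℤ → A)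
    (α : ℤ) : Prop :=
  ∀ s c c' e i k i' k' : ℤ, α ≤ e - s → e - s ≤ α + 1 →
    (s ≤ c ∧ c < e ∧ c - s < α ∧ e - c ≤ α) → (s ≤ c' ∧ c' < e ∧ c' - s < α ∧ e - c' ≤ α) →
    IsArgMin f s c i → IsArgMin f (c + 1) e k → IsArgMin f s c' i' → IsArgMin f (c' + 1) e k' →
    G i + G k = G i' + G k'

/-- Both ends of the window `[s, s + α]` are below its interior. -/
def IsBasin {V : Type*} [LinearOrder V] (f : ℤ → V) (α s : ℤ) : Prop :=
  ∀ j, s < j → j < s + α → f s < f j ∧ f (s + α) < f j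

/-! ### Cut-invariant functions on sliding windows -/

section Windows

variable {V A : Type*} [LinearOrder V] [AddCommGroup A] {f : ℤ → V} {G : ℤ → A} {α : ℤ}

theorem exists_isArgMin (f : ℤ → V) {s e : ℤ} (h : s ≤ e) : ∃ i, IsArgMin f s e i := by
  obtain ⟨i, hi, hmin⟩ := Finset.exists_min_image (Finset.Icc s e) f ⟨s, by simp [h]⟩
  rw [Finset.mem_Icc] at hi
  exact ⟨i, hi.1, hi.2, fun j h1 h2 => hmin j (Finset.mem_Icc.2 ⟨h1, h2⟩)⟩

theorem IsArgMin.mono {s e s' e' i : ℤ} (h : IsArgMin f s e i) (hs : s ≤ s') (he : e' ≤ e)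
    (h1 : s' ≤ i) (h2 : i ≤ e') : IsArgMin f s' e' i :=
  ⟨h1, h2, fun j hj hj' => h.2.2 j (hs.trans hj) (hj'.trans he)⟩

theorem IsArgMin.cons {s e i : ℤ} (h : IsArgMin f (s + 1) e i) (hlt : f i < f s) :
    IsArgMin f s e i := by
  refine ⟨by have := h.1; lia, h.2.1, fun j hj hj' => ?_⟩
  rcases eq_or_ne j s with rfl | hne
  · exact hlt.le
  · exact h.2.2 j (by lia) hj'

theorem IsArgMin.snoc {s e i : ℤ} (h : IsArgMin f s e i) (hlt : f i < f (e + 1)) :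
    IsArgMin f s (e + 1) i := by
  refine ⟨h.1, by have := h.2.1; lia, fun j hj hj' => ?_⟩
  rcases eq_or_ne j (e + 1) with rfl | hne
  · exact hlt.le
  · exact h.2.2 j hj (by lia)

theorem IsArgMin.head {s e i : ℤ} (h : IsArgMin f (s + 1) e i) (hlt : f s < f i) :
    IsArgMin f s e s := by
  refine ⟨le_rfl, by have := h.1; have := h.2.1; lia, fun j hj hj' => ?_⟩
  rcases eq_or_ne j s with rfl | hne
  · exact le_rfl
  · exact hlt.le.trans (h.2.2 j (by lia) hj')

theorem IsArgMin.last {s e i : ℤ} (h : IsArgMin f s e i) (hlt : f (e + 1) < f i) :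
    IsArgMin f s (e + 1) (e + 1) := by
  refine ⟨by have := h.1; have := h.2.1; lia, le_rfl, fun j hj hj' => ?_⟩
  rcases eq_or_ne j (e + 1) with rfl | hne
  · exact le_rfl
  · exact hlt.le.trans (h.2.2 j hj (by lia))

theorem isArgMin_singleton (f : ℤ → V) (s : ℤ) : IsArgMin f s s s :=
  ⟨le_rfl, le_rfl, fun j h1 h2 => by rw [le_antisymm h1 h2]⟩

variable (hα : 2 ≤ α) (hinj : ∀ i j, i < j → j ≤ i + α + 1 → f i ≠ f j)
  (hG : CutInvariant f G α)

include hinj in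
theorem IsArgMin.unique {s e i j : ℤ} (hse : e - s ≤ α + 1) (hi : IsArgMin f s e i)
    (hj : IsArgMin f s e j) : i = j := by
  obtain ⟨h1, h2, h3⟩ := hi
  obtain ⟨h4, h5, h6⟩ := hj
  have h := le_antisymm (h3 j h4 h5) (h6 i h1 h2)
  rcases lt_trichotomy i j with hlt | heq | hlt
  · exact absurd h (hinj i j hlt (by lia))
  · exact heq
  · exact absurd h.symm (hinj j i hlt (by lia))

-- For each cut, one part contains the overall minimum `a`, so the other part's value is the
-- cut-independent sum minus `G a`.
include hinj hG in
theorem IsSecondVal.unique {s e : ℤ} {x y : A} (h1 : α ≤ e - s) (h2 : e - s ≤ α + 1)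
    (hx : IsSecondVal f G α s e x) (hy : IsSecondVal f G α s e y) : x = y := by
  obtain ⟨a, c, k, ha, hc, hk, rfl⟩ := hx
  obtain ⟨a', c', k', ha', hc', hk', rfl⟩ := hy
  obtain rfl := ha.unique hinj h2 ha'
  have e1 := ha.1
  have e2 := ha.2.1
  rcases hk with ⟨hac, hk⟩ | ⟨hac, hk⟩ <;> rcases hk' with ⟨hac', hk'⟩ | ⟨hac', hk'⟩
  · exact add_left_cancel (hG s c c' e a k a k' h1 h2 hc hc' (ha.mono le_rfl (by lia) e1 hac) hk
      (ha.mono le_rfl (by lia) e1 hac') hk')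
  · have := hG s c c' e a k k' a h1 h2 hc hc' (ha.mono le_rfl (by lia) e1 hac) hk hk'
      (ha.mono (by lia) le_rfl (by lia) e2)
    rw [add_comm (G k')] at this
    exact add_left_cancel this
  · have := hG s c c' e k a a k' h1 h2 hc hc' hk (ha.mono (by lia) le_rfl (by lia) e2)
      (ha.mono le_rfl (by lia) e1 hac') hk'
    rw [add_comm (G k)] at this
    exact add_left_cancel this
  · exact add_right_cancel (hG s c c' e k a k' a h1 h2 hc hc' hk
      (ha.mono (by lia) le_rfl (by lia) e2) hk' (ha.mono (by lia) le_rfl (by lia) e2))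

omit [AddCommGroup A] in
theorem isSecondVal_suffix {s e a c k : ℤ} (ha : IsArgMin f s e a)
    (hc : s ≤ c ∧ c < e ∧ c - s < α ∧ e - c ≤ α) (hac : a ≤ c) (hk : IsArgMin f (c + 1) e k) :
    IsSecondVal f G α s e (G k) :=
  ⟨a, c, k, ha, hc, Or.inl ⟨hac, hk⟩, rfl⟩

omit [AddCommGroup A] in
theorem isSecondVal_prefix {s e a c k : ℤ} (ha : IsArgMin f s e a)
    (hc : s ≤ c ∧ c < e ∧ c - s < α ∧ e - c ≤ α) (hac : c < a) (hk : IsArgMin f s c k) :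
    IsSecondVal f G α s e (G k) :=
  ⟨a, c, k, ha, hc, Or.inr ⟨hac, hk⟩, rfl⟩

include hα in
theorem exists_isSecondVal (f : ℤ → V) (G : ℤ → A) (s : ℤ) :
    ∃ x, IsSecondVal f G α s (s + α) x := by
  obtain ⟨a, ha⟩ := exists_isArgMin f (s := s) (e := s + α) (by lia)
  by_cases h : a = s
  · obtain ⟨k, hk⟩ := exists_isArgMin f (s := s + 1) (e := s + α) (by lia)
    exact ⟨_, isSecondVal_suffix ha ⟨le_rfl, by lia, by lia, by lia⟩ h.le hk⟩
  · exact ⟨_, isSecondVal_prefix ha ⟨le_rfl, by lia, by lia, by lia⟩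
      (by have := ha.1; lia) (isArgMin_singleton f s)⟩

-- Everything is compared with the minimum `c` of the overlap `[s + 1, s + α]`. Suitable cuts often
-- give both windows the same second minimum; otherwise two cuts of their union, which has `α + 2`
-- positions, link the two values. The configurations where no such cuts exist are basins.
include hα hinj hG in
theorem secondVal_succ {s : ℤ} {x y : A} (hs : ¬ IsBasin f α s) (hs' : ¬ IsBasin f α (s + 1))
    (hx : IsSecondVal f G α s (s + α) x) (hy : IsSecondVal f G α (s + 1) (s + α + 1) y) :
    x = y := by
  have ux : ∀ {z}, IsSecondVal f G α s (s + α) z → x = z :=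
    fun hz => hx.unique hinj hG (by lia) (by lia) hz
  have uy : ∀ {z}, IsSecondVal f G α (s + 1) (s + α + 1) z → y = z :=
    fun hz => hy.unique hinj hG (by lia) (by lia) hz
  have uT : ∀ {z w}, IsSecondVal f G α s (s + α + 1) z → IsSecondVal f G α s (s + α + 1) w →
    z = w := fun hz hw => hz.unique hinj hG (by lia) (by lia) hw
  have lastBasin : ∀ k, IsArgMin f (s + 2) (s + α) k → f (s + 1) < f k →
      f (s + α + 1) < f k → False := fun k hk h1 h2 => hs' fun j hj hj' => by
    have := hk.2.2 j (by lia) (by lia)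
    rw [show s + 1 + α = s + α + 1 by ring]
    exact ⟨h1.trans_le this, h2.trans_le this⟩
  have headBasin : ∀ k, IsArgMin f (s + 1) (s + α - 1) k → f s < f k →
      f (s + α) < f k → False := fun k hk h1 h2 => hs fun j hj hj' => by
    have := hk.2.2 j (by lia) (by lia)
    exact ⟨h1.trans_le this, h2.trans_le this⟩
  obtain ⟨c, hc⟩ := exists_isArgMin f (s := s + 1) (e := s + α) (by lia)
  have c1 := hc.1
  have c2 := hc.2.1
  have strict : ∀ {u v k}, s + 1 ≤ u → v ≤ s + α → (c < u ∨ v < c) → IsArgMin f u v k →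
      f c < f k := by
    intro u v k hu hv huv hk
    have k1 := hk.1
    have k2 := hk.2.1
    refine lt_of_le_of_ne (hc.2.2 k (by lia) (by lia)) ?_
    rcases huv with h | h
    · exact hinj _ _ (by lia) (by lia)
    · exact (hinj _ _ (by lia) (by lia)).symm
  have hnel : f s ≠ f c := hinj _ _ (by lia) (by lia)
  have hner : f c ≠ f (s + α + 1) := hinj _ _ (by lia) (by lia)
  rcases lt_or_gt_of_ne hnel with hl | hl <;> rcases lt_or_gt_of_ne hner with hr | hr
  · -- `f s < f c < f (s + α + 1)`
    have a1 : IsArgMin f s (s + α) s := hc.head hl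
    have a2 : IsArgMin f (s + 1) (s + α + 1) c := hc.snoc hr
    have xc := ux (isSecondVal_suffix a1 ⟨le_rfl, by lia, by lia, by lia⟩ le_rfl hc)
    have hcα : c < s + α := by
      by_contra hcon
      obtain rfl : c = s + α := by lia
      obtain ⟨k, hk⟩ := exists_isArgMin f (s := s + 1) (e := s + α - 1) (by lia)
      have := strict le_rfl (by lia) (by lia) hk
      exact headBasin k hk (hl.trans this) this
    obtain ⟨k, hk⟩ := exists_isArgMin f (s := c + 1) (e := s + α) (by lia)
    have hck := strict (by lia) le_rfl (by lia) hk
    have k1 := hk.1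
    have k2 := hk.2.1
    have xk := ux (isSecondVal_suffix a1 ⟨by lia, by lia, by lia, by lia⟩ (by lia) hk)
    rcases lt_or_gt_of_ne (hinj k (s + α + 1) (by lia) (by lia)) with hkr | hkr
    · rw [xk, uy (isSecondVal_suffix a2 ⟨by lia, by lia, by lia, by lia⟩ le_rfl (hk.snoc hkr))]
    · have hcs : c ≠ s + 1 := by
        rintro rfl
        exact lastBasin k (by convert hk using 1; ring) hck hkr
      -- The second values found are `G c` and `G (s + α + 1)`; two different cuts of the union
      -- window produce exactly these.
      have a3 : IsArgMin f s (s + α + 1) s := a2.head hl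
      have T1 : IsSecondVal f G α s (s + α + 1) (G c) :=
        isSecondVal_suffix a3 (c := s + 1) ⟨by lia, by lia, by lia, by lia⟩ (by lia)
          (a2.mono (by lia) le_rfl (by lia) (by lia))
      have T2 : IsSecondVal f G α s (s + α + 1) (G (s + α + 1)) :=
        isSecondVal_suffix a3 (c := s + α - 1) ⟨by lia, by lia, by lia, by lia⟩ (by lia)
          ((hk.last hkr).mono (by lia) le_rfl (by lia) le_rfl)
      rw [xc, uT T1 T2, uy (isSecondVal_suffix a2 ⟨by lia, by lia, by lia, by lia⟩ le_rfl
        (hk.last hkr))]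
  · -- both ends below
    rw [ux (isSecondVal_suffix (hc.head hl) ⟨le_rfl, by lia, by lia, by lia⟩ le_rfl hc),
      uy (isSecondVal_prefix (hc.last hr) ⟨by lia, by lia, by lia, by lia⟩ (by lia) hc)]
  · -- both ends above
    have a1 : IsArgMin f s (s + α) c := hc.cons hl
    have a2 : IsArgMin f (s + 1) (s + α + 1) c := hc.snoc hr
    have a3 : IsArgMin f s (s + α + 1) c := a2.cons hl
    by_cases hcl : c = s + 1
    · subst hcl
      obtain ⟨k, hk⟩ := exists_isArgMin f (s := s + 2) (e := s + α) (by lia)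
      have hck := strict (by lia) le_rfl (by lia) hk
      have k1 := hk.1
      have k2 := hk.2.1
      rcases lt_or_gt_of_ne (hinj k (s + α + 1) (by lia) (by lia)) with hkr | hkr
      · rw [ux (isSecondVal_suffix a1 ⟨by lia, by lia, by lia, by lia⟩ le_rfl
          (by convert hk using 1; ring)), uy (isSecondVal_suffix a2
          ⟨by lia, by lia, by lia, by lia⟩ le_rfl
          (by convert hk.snoc hkr using 1; ring))]
      · exact (lastBasin k hk hck hkr).elim
    · obtain ⟨i, hi⟩ := exists_isArgMin f (s := s + 1) (e := c - 1) (by lia)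
      have hci := strict le_rfl (by lia) (by lia) hi
      have i1 := hi.1
      have i2 := hi.2.1
      rcases lt_or_gt_of_ne (hinj s i (by lia) (by lia)) with hil | hil
      · by_cases hcr : c = s + α
        · subst hcr
          exact (headBasin i hi hil hci).elim
        · obtain ⟨k, hk⟩ := exists_isArgMin f (s := c + 1) (e := s + α) (by lia)
          have hck := strict (by lia) le_rfl (by lia) hk
          have k1 := hk.1
          have k2 := hk.2.1
          rcases lt_or_gt_of_ne (hinj k (s + α + 1) (by lia) (by lia)) with hkr | hkr
          · rw [ux (isSecondVal_suffix a1 ⟨by lia, by lia, by lia, by lia⟩ le_rfl hk),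
              uy (isSecondVal_suffix a2 ⟨by lia, by lia, by lia, by lia⟩ le_rfl (hk.snoc hkr))]
          · have T1 : IsSecondVal f G α s (s + α + 1) (G s) :=
              isSecondVal_prefix a3 ⟨by lia, by lia, by lia, by lia⟩ (by lia) (hi.head hil)
            have T2 : IsSecondVal f G α s (s + α + 1) (G (s + α + 1)) :=
              isSecondVal_suffix a3 ⟨by lia, by lia, by lia, by lia⟩ le_rfl (hk.last hkr)
            rw [ux (isSecondVal_prefix a1 ⟨by lia, by lia, by lia, by lia⟩ (by lia)
              (hi.head hil)), uT T1 T2, uy (isSecondVal_suffix a2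
              ⟨by lia, by lia, by lia, by lia⟩ le_rfl (hk.last hkr))]
      · rw [ux (isSecondVal_prefix a1 ⟨by lia, by lia, by lia, by lia⟩ (by lia) (hi.cons hil)),
          uy (isSecondVal_prefix a2 ⟨by lia, by lia, by lia, by lia⟩ (by lia) hi)]
  · -- `f (s + α + 1) < f c < f s`
    have a1 : IsArgMin f (s + 1) (s + α + 1) (s + α + 1) := hc.last hr
    have a2 : IsArgMin f s (s + α) c := hc.cons hl
    have yc := uy (isSecondVal_prefix a1 ⟨by lia, by lia, by lia, by lia⟩ (by lia) hc)
    have hcs : s + 1 < c := by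
      by_contra hcon
      obtain rfl : c = s + 1 := by lia
      obtain ⟨k, hk⟩ := exists_isArgMin f (s := s + 2) (e := s + α) (by lia)
      have := strict (by lia) le_rfl (by lia) hk
      exact lastBasin k hk this (hr.trans this)
    obtain ⟨i, hi⟩ := exists_isArgMin f (s := s + 1) (e := c - 1) (by lia)
    have hci := strict le_rfl (by lia) (by lia) hi
    have i1 := hi.1
    have i2 := hi.2.1
    have yi := uy (isSecondVal_prefix a1 ⟨by lia, by lia, by lia, by lia⟩ (by lia) hi)
    rcases lt_or_gt_of_ne (hinj s i (by lia) (by lia)) with hil | hil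
    · have hcα : c ≠ s + α := by
        rintro rfl
        exact headBasin i hi hil hci
      have a3 : IsArgMin f s (s + α + 1) (s + α + 1) := a2.last hr
      have T1 : IsSecondVal f G α s (s + α + 1) (G c) :=
        isSecondVal_prefix a3 (c := s + α - 1) ⟨by lia, by lia, by lia, by lia⟩ (by lia)
          (a2.mono le_rfl (by lia) (by lia) (by lia))
      have T2 : IsSecondVal f G α s (s + α + 1) (G s) :=
        isSecondVal_prefix a3 (c := s + 1) ⟨by lia, by lia, by lia, by lia⟩ (by lia)
          ((hi.head hil).mono le_rfl (by lia) le_rfl (by lia))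
      rw [yc, uT T1 T2, ux (isSecondVal_prefix a2 (c := c - 1) ⟨by lia, by lia, by lia, by lia⟩
        (by lia) (hi.head hil))]
    · rw [yi, ux (isSecondVal_prefix a2 ⟨by lia, by lia, by lia, by lia⟩ (by lia) (hi.cons hil))]

-- The neighbouring windows can each be cut so that one part is the interior of the basin. Neither
-- has its minimum there, as an end of the basin lies below, so both second values are `G` at the
-- interior minimum.
include hα hinj hG in
theorem secondVal_across_basin {s : ℤ} {x y : A} (hs : IsBasin f α s)
    (hx : IsSecondVal f G α (s - 1) (s - 1 + α) x)
    (hy : IsSecondVal f G α (s + 1) (s + 1 + α) y) : x = y := by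
  obtain ⟨c, hc⟩ := exists_isArgMin f (s := s + 1) (e := s + α - 1) (by lia)
  have c1 := hc.1
  have c2 := hc.2.1
  obtain ⟨a, ha⟩ := exists_isArgMin f (s := s - 1) (e := s - 1 + α) (by lia)
  obtain ⟨b, hb⟩ := exists_isArgMin f (s := s + 1) (e := s + 1 + α) (by lia)
  have ha' : a ≤ s := by
    by_contra h
    exact absurd (ha.2.2 s (by lia) (by lia)) (hs a (by lia) (by have := ha.2.1; lia)).1.not_ge
  have hb' : s + α - 1 < b := by
    by_contra h
    exact absurd (hb.2.2 (s + α) (by lia) (by lia))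
      (hs b (by have := hb.1; lia) (by lia)).2.not_ge
  rw [hx.unique hinj hG (by lia) (by lia) (isSecondVal_suffix ha (c := s)
      ⟨by lia, by lia, by lia, by lia⟩ ha' (by convert hc using 1; ring)),
    hy.unique hinj hG (by lia) (by lia) (isSecondVal_prefix hb (c := s + α - 1)
      ⟨by lia, by lia, by lia, by lia⟩ hb' hc)]

include hα hinj hG in
/-- A cut invariant `G` takes the same value at all positions which are not minimal among the
positions at distance less than `α`. -/
theorem CutInvariant.eq_of_not_local_min {i j i' j' : ℤ} (hi : |i - i'| < α) (hfi : f i' < f i)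
    (hj : |j - j'| < α) (hfj : f j' < f j) : G i = G j := by
  classical
  choose κ hκ using fun s => exists_isSecondVal hα f G s
  -- In a basin the second minimum is always one of the two ends, possibly a local minimum, so its
  -- value is not usable. It is replaced by that of the next window, which is never a basin.
  set κ' : ℤ → A := fun s => if IsBasin f α s then κ (s + 1) else κ s with hκ'
  have hbasin : ∀ s, IsBasin f α s → ¬ IsBasin f α (s + 1) := fun s h h' =>
    lt_asymm (h (s + 1) (by lia) (by lia)).2 (h' (s + α) (by lia) (by lia)).1
  have hstep : ∀ s, κ' s = κ' (s + 1) := by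
    intro s
    by_cases h : IsBasin f α s
    · simp [hκ', h, hbasin s h]
    · by_cases h' : IsBasin f α (s + 1)
      · simp only [hκ', h, h', if_true, if_false]
        refine secondVal_across_basin hα hinj hG h' ?_ (hκ _)
        convert hκ s using 1 <;> ring
      · simp only [hκ', h, h', if_false]
        refine secondVal_succ hα hinj hG h h' (hκ s) ?_
        convert hκ (s + 1) using 1; ring
  have hconst : ∀ s, κ' s = κ' 0 := by
    intro s
    induction s using Int.induction_on with
    | zero => rfl
    | succ n ih => rw [← hstep, ih]
    | pred n ih => rw [hstep, sub_add_cancel, ih]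
  -- Use the window that has `i` as an end and contains `i'` in its interior: it is no basin, its
  -- minimum is not `i`, and cutting off `{i}` makes `G i` its second value.
  have key : ∀ i i' : ℤ, |i - i'| < α → f i' < f i → G i = κ' 0 := by
    intro i i' h hlt
    rw [abs_lt] at h
    have hne : i ≠ i' := by rintro rfl; exact lt_irrefl _ hlt
    rcases lt_or_gt_of_ne hne with hii | hii
    · have hb : ¬ IsBasin f α i := fun hb => lt_asymm (hb i' hii (by lia)).1 hlt
      obtain ⟨a, ha⟩ := exists_isArgMin f (s := i) (e := i + α) (by lia)
      have hai : i < a := by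
        refine lt_of_le_of_ne ha.1 ?_
        rintro rfl
        exact absurd (ha.2.2 i' hii.le (by lia)) hlt.not_ge
      rw [← hconst i]
      simp only [hκ', hb, if_false]
      exact (isSecondVal_prefix ha ⟨le_rfl, by lia, by lia, by lia⟩ hai
        (isArgMin_singleton f i)).unique hinj hG (by lia) (by lia) (hκ i)
    · have hb : ¬ IsBasin f α (i - α) := fun hb => by
        have := (hb i' (by lia) (by lia)).2
        rw [sub_add_cancel] at this
        exact lt_asymm this hlt
      obtain ⟨a, ha⟩ := exists_isArgMin f (s := i - α) (e := i - α + α) (by lia)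
      have hai : a ≤ i - 1 := by
        have h1 : a ≠ i := by
          rintro rfl
          exact absurd (ha.2.2 i' (by lia) (by lia)) hlt.not_ge
        have := ha.2.1
        lia
      rw [← hconst (i - α)]
      simp only [hκ', hb, if_false]
      refine (isSecondVal_suffix ha (c := i - 1) ⟨by lia, by lia, by lia, by lia⟩ hai
        (?_ : IsArgMin f _ _ i)).unique hinj hG (by lia) (by lia) (hκ (i - α))
      convert isArgMin_singleton f i using 1 <;> ring
  rw [key i i' hi hfi, key j j' hj hfj]

end Windows

/-! ### Cyclic arrangements and sums over class minima -/

/-- `pos` arranges the vertices of `H` on a cycle of length `α * m + 1` in such a way that any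
`α` consecutive vertices form a stable set. -/
structure IsCyclicArrangement {W : Type*} (H : SimpleGraph W) (α m : ℤ) (pos : ℤ → W) : Prop where
  two_le_width : 2 ≤ α
  two_le_count : 2 ≤ m
  eq_iff : ∀ i j, pos i = pos j ↔ α * m + 1 ∣ i - j
  surjective : Function.Surjective pos
  stable : ∀ i j, i < j → j < i + α → ¬ H.Adj (pos i) (pos j)

/-- The sum of `g` over the least elements of the colour classes is `K` for every proper
colouring with the colours `0, …, n - 1`. -/
def IsClassMinSum {W A : Type*} [Fintype W] [LinearOrder W] [AddCommGroup A]
    (H : SimpleGraph W) (n : ℕ) (g : W → A) (K : A) : Prop :=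
  ∀ C : W → ℕ, (∀ v, C v < n) → (∀ u v, C u = C v → ¬ H.Adj u v) →
    (∑ v with ∀ w, C w = C v → v ≤ w, g v) = K

section ClassMin

variable {W A : Type*} [Fintype W] [LinearOrder W] [AddCommGroup A]

/-- The colourings differ only inside the union of the classes `a` and `b`, so all other minima
cancel. -/
theorem class_min_exchange {κ : Type*} [DecidableEq κ] {C C' : W → κ} {g : W → A} {a b : κ}
    {k l k' l' : W}
    (hsum : (∑ v with ∀ w, C w = C v → v ≤ w, g v) = ∑ v with ∀ w, C' w = C' v → v ≤ w, g v)
    (hab : a ≠ b) (hiff : ∀ x, (C x = a ∨ C x = b) ↔ (C' x = a ∨ C' x = b))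
    (hother : ∀ x, ¬ (C x = a ∨ C x = b) → C' x = C x)
    (hk : IsLeast {x | C x = a} k) (hl : IsLeast {x | C x = b} l)
    (hk' : IsLeast {x | C' x = a} k') (hl' : IsLeast {x | C' x = b} l') :
    g k + g l = g k' + g l' := by
  have main : ∀ {D : W → κ} {k l : W}, IsLeast {x | D x = a} k → IsLeast {x | D x = b} l →
      (∑ v with ∀ w, D w = D v → v ≤ w, g v) = g k + g l +
        ∑ v with (∀ w, D w = D v → v ≤ w) ∧ ¬ (D v = a ∨ D v = b), g v := by
    intro D k l hk hl
    have hka : D k = a := hk.1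
    have hlb : D l = b := hl.1
    have hkl : k ≠ l := by rintro rfl; exact hab (hka.symm.trans hlb)
    rw [← Finset.sum_filter_add_sum_filter_not _ (fun v => D v = a ∨ D v = b), Finset.filter_filter,
      Finset.filter_filter, ← Finset.sum_pair hkl]
    congr 2
    ext v
    simp only [Finset.mem_filter, Finset.mem_univ, true_and, Finset.mem_insert,
      Finset.mem_singleton]
    constructor
    · rintro ⟨h1, h2 | h2⟩
      · exact Or.inl (le_antisymm (h1 k (hka.trans h2.symm)) (hk.2 h2))
      · exact Or.inr (le_antisymm (h1 l (hlb.trans h2.symm)) (hl.2 h2))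
    · rintro (rfl | rfl)
      · exact ⟨fun w hw => hk.2 (hw.trans hka), Or.inl hka⟩
      · exact ⟨fun w hw => hl.2 (hw.trans hlb), Or.inr hlb⟩
  rw [main hk hl, main hk' hl'] at hsum
  have hrest : (∑ v with (∀ w, C w = C v → v ≤ w) ∧ ¬ (C v = a ∨ C v = b), g v) =
      ∑ v with (∀ w, C' w = C' v → v ≤ w) ∧ ¬ (C' v = a ∨ C' v = b), g v := by
    refine Finset.sum_congr ?_ fun _ _ => rfl
    ext v
    simp only [Finset.mem_filter, Finset.mem_univ, true_and, ← hiff v]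
    refine and_congr_left fun hv => forall_congr' fun w => ?_
    rw [hother v hv]
    have : C' w = C v ↔ C w = C v := by
      by_cases hw : C w = a ∨ C w = b
      · have hw' := (hiff w).1 hw
        constructor
        · intro h; rw [h] at hw'; exact absurd hw' hv
        · intro h; rw [h] at hw; exact absurd hw hv
      · rw [hother w hw]
    rw [this]
  rw [hrest] at hsum
  exact add_right_cancel hsum

theorem IsClassMinSum.sum_int_eq {H : SimpleGraph W} {n : ℕ} {g : W → A} {K : A}
    (h : IsClassMinSum H n g K) (C : W → ℤ) (h0 : ∀ v, 0 ≤ C v) (hn : ∀ v, C v < n)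
    (hC : ∀ u v, C u = C v → ¬ H.Adj u v) : (∑ v with ∀ w, C w = C v → v ≤ w, g v) = K := by
  have key : ∀ u v, (C u).toNat = (C v).toNat ↔ C u = C v := by
    intro u v
    have := h0 u
    have := h0 v
    lia
  have := h (fun v => (C v).toNat) (fun v => by have := h0 v; have := hn v; lia)
    (fun u v huv => hC u v ((key u v).1 huv))
  simpa only [key] using this

end ClassMin

namespace IsCyclicArrangement

section Index

variable {W : Type*} {H : SimpleGraph W} {α m : ℤ} {pos : ℤ → W}

theorem length_pos (h : IsCyclicArrangement H α m pos) : 0 < α * m + 1 := by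
  have := h.two_le_width
  have := h.two_le_count
  positivity

theorem exists_index (h : IsCyclicArrangement H α m pos) (s : ℤ) (v : W) :
    ∃ i, s ≤ i ∧ i < s + (α * m + 1) ∧ pos i = v := by
  obtain ⟨j, rfl⟩ := h.surjective v
  have hq := h.length_pos
  refine ⟨s + (j - s) % (α * m + 1), ?_, ?_, ?_⟩
  · have := Int.emod_nonneg (j - s) hq.ne'
    lia
  · have := Int.emod_lt_of_pos (j - s) hq
    lia
  · rw [h.eq_iff]
    refine ⟨-((j - s) / (α * m + 1)), ?_⟩
    have := Int.mul_ediv_add_emod (j - s) (α * m + 1)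
    linarith

/-- The position of `v` in the period that starts at `s`. -/
noncomputable def index (h : IsCyclicArrangement H α m pos) (s : ℤ) (v : W) : ℤ :=
  (h.exists_index s v).choose

variable (h : IsCyclicArrangement H α m pos)

include h

theorem le_index (s : ℤ) (v : W) : s ≤ h.index s v := (h.exists_index s v).choose_spec.1

theorem index_lt (s : ℤ) (v : W) : h.index s v < s + (α * m + 1) :=
  (h.exists_index s v).choose_spec.2.1

theorem pos_index (s : ℤ) (v : W) : pos (h.index s v) = v :=
  (h.exists_index s v).choose_spec.2.2

theorem index_pos {s i : ℤ} (h1 : s ≤ i) (h2 : i < s + (α * m + 1)) : h.index s (pos i) = i := by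
  have hd := (h.eq_iff _ _).1 (h.pos_index s (pos i))
  have := Int.eq_zero_of_abs_lt_dvd hd
    (abs_lt.2 ⟨by linarith [h.le_index s (pos i)], by linarith [h.index_lt s (pos i)]⟩)
  linarith

theorem not_adj_of_close {s : ℤ} {u v : W} (huv : |h.index s u - h.index s v| < α) :
    ¬ H.Adj u v := by
  intro hadj
  have h1 := h.pos_index s u
  have h2 := h.pos_index s v
  rw [abs_lt] at huv
  rcases lt_trichotomy (h.index s u) (h.index s v) with hlt | heq | hlt
  · have := h.stable _ _ hlt (by lia)
    rw [h1, h2] at this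
    exact this hadj
  · rw [heq] at h1
    exact hadj.ne (h1.symm.trans h2)
  · have := h.stable _ _ hlt (by lia)
    rw [h1, h2] at this
    exact this hadj.symm

theorem le_length : 2 * α ≤ α * m := by
  have := h.two_le_width
  have := h.two_le_count
  nlinarith

end Index

theorem close_of_ediv_eq {α x y : ℤ} (hα : 0 < α) (h : x / α = y / α) : |x - y| < α := by
  have h1 := Int.mul_ediv_add_emod x α
  have h2 := Int.mul_ediv_add_emod y α
  have := Int.emod_nonneg x hα.ne'
  have := Int.emod_nonneg y hα.ne'
  have := Int.emod_lt_of_pos x hα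
  have := Int.emod_lt_of_pos y hα
  rw [h] at h1
  rw [abs_lt]
  constructor <;> linarith

section Core

variable {W A : Type*} [Fintype W] [LinearOrder W] [AddCommGroup A] {H : SimpleGraph W}
  {α m : ℤ} {pos : ℤ → W} (h : IsCyclicArrangement H α m pos)

/-- The colouring with the classes `[s, c]`, `[c + 1, e]`, and intervals of length `α`. -/
noncomputable def twoCutColoring (s c e : ℤ) (v : W) : ℤ :=
  if h.index s v ≤ c then 0 else if h.index s v ≤ e then 1 else 2 + (h.index s v - e - 1) / α

include h

/-- Outside `[s, e]` at most `α * (m - 1)` vertices remain, enough for `m - 1` intervals of length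
at most `α`. Hence every admissible cut extends to an `n`-colouring, and only the first two classes
depend on it. -/
theorem cutInvariant {n : ℕ} (hn : (n : ℤ) = m + 1) {g : W → A} {K : A}
    (hg : IsClassMinSum H n g K) : CutInvariant pos (fun i => g (pos i)) α := by
  have hα := h.two_le_width
  have hm := h.two_le_count
  have hlen := h.le_length
  have tail : ∀ {e i : ℤ}, e < i → 0 ≤ (i - e - 1) / α := fun hi =>
    Int.ediv_nonneg (by lia) (by lia)
  have sum_eq : ∀ s c e, α ≤ e - s → (s ≤ c ∧ c < e ∧ c - s < α ∧ e - c ≤ α) →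
      (∑ v with ∀ w, h.twoCutColoring s c e w = h.twoCutColoring s c e v → v ≤ w, g v) = K := by
    intro s c e hse hc
    refine hg.sum_int_eq _ (fun v => ?_) (fun v => ?_) (fun u v huv => ?_)
    · unfold twoCutColoring
      split_ifs with h1 h2
      · exact le_rfl
      · exact zero_le_one
      · have := @tail e (h.index s v) (by lia)
        lia
    · rw [hn]
      unfold twoCutColoring
      split_ifs with h1 h2
      · lia
      · lia
      · have : (h.index s v - e - 1) / α < m - 1 := by
          apply Int.ediv_lt_of_lt_mul (by lia)
          have := h.index_lt s v
          linarith
        lia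
    · apply h.not_adj_of_close (s := s)
      have u1 := h.le_index s u
      have v1 := h.le_index s v
      unfold twoCutColoring at huv
      split_ifs at huv with h1 h2 h3 h4 h5 h6 h7 h8
      · rw [abs_lt]; constructor <;> lia
      · lia
      · have := @tail e (h.index s v) (by lia); lia
      · lia
      · rw [abs_lt]; constructor <;> lia
      · have := @tail e (h.index s v) (by lia); lia
      · have := @tail e (h.index s u) (by lia); lia
      · have := @tail e (h.index s u) (by lia); lia
      · have := close_of_ediv_eq (by lia : 0 < α) (add_left_cancel huv)
        rw [abs_lt] at this ⊢
        constructor <;> lia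
  intro s c c' e i k i' k' h1 h2 hc hc' hi hk hi' hk'
  have zero_iff : ∀ c v, h.twoCutColoring s c e v = 0 ↔ h.index s v ≤ c := by
    intro c v
    unfold twoCutColoring
    split_ifs with h1 h2
    · simp [h1]
    · simp [h1]
    · have := @tail e (h.index s v) (by lia)
      exact ⟨fun _ => by lia, fun _ => by lia⟩
  have one_iff : ∀ c v, h.twoCutColoring s c e v = 1 ↔ c < h.index s v ∧ h.index s v ≤ e := by
    intro c v
    unfold twoCutColoring
    split_ifs with h1 h2
    · simp [h1]
    · simp [h2]; lia
    · have := @tail e (h.index s v) (by lia)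
      exact ⟨fun _ => by lia, fun _ => by lia⟩
  have least0 : ∀ {c i}, c < e → IsArgMin pos s c i →
      IsLeast {x | h.twoCutColoring s c e x = 0} (pos i) := by
    intro c i hc hi
    have i1 := hi.1
    have i2 := hi.2.1
    refine ⟨?_, fun x hx => ?_⟩
    · simp only [Set.mem_ofPred_eq, zero_iff]
      rwa [h.index_pos i1 (by lia)]
    · simp only [Set.mem_ofPred_eq, zero_iff] at hx
      have := hi.2.2 _ (h.le_index s x) hx
      rwa [h.pos_index] at this
  have least1 : ∀ {c k}, s ≤ c → IsArgMin pos (c + 1) e k →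
      IsLeast {x | h.twoCutColoring s c e x = 1} (pos k) := by
    intro c k hc hk
    have i1 := hk.1
    have i2 := hk.2.1
    refine ⟨?_, fun x hx => ?_⟩
    · simp only [Set.mem_ofPred_eq, one_iff]
      rw [h.index_pos (by lia) (by lia)]
      lia
    · simp only [Set.mem_ofPred_eq, one_iff] at hx
      have := hk.2.2 _ (by lia) hx.2
      rwa [h.pos_index] at this
  refine class_min_exchange ((sum_eq s c e h1 hc).trans (sum_eq s c' e h1 hc').symm)
    zero_ne_one (fun x => ?_) (fun x hx => ?_) (least0 hc.2.1 hi) (least1 hc.1 hk)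
    (least0 hc'.2.1 hi') (least1 hc'.1 hk')
  · rw [zero_iff, zero_iff, one_iff, one_iff]
    lia
  · rw [zero_iff, one_iff] at hx
    unfold twoCutColoring
    rw [if_neg (by lia), if_neg (by lia), if_neg (by lia)]

/-- The colouring with the classes `{pos i}` and intervals of length `α`. -/
noncomputable def singletonColoring (i : ℤ) (v : W) : ℤ :=
  if h.index i v ≤ i then 0 else 1 + (h.index i v - i - 1) / α

/-- Make `v` a singleton class and split the other `α * m` vertices into `m` blocks of length `α`.
Moving `u` into the class of `v` changes the minimum of that class to `u`, and comparing the two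
sums equates `g v` with `g` at a vertex of the block of `u` that is not its minimum. -/
theorem exists_not_local_min {n : ℕ} (hn : (n : ℤ) = m + 1) {g : W → A} {K : A}
    (hg : IsClassMinSum H n g K) {u v : W} (huv : u < v) (hadj : ¬ H.Adj u v) :
    ∃ j j', |j - j'| < α ∧ pos j' < pos j ∧ g v = g (pos j) := by
  classical
  have hα := h.two_le_width
  have hm := h.two_le_count
  have hlen := h.le_length
  obtain ⟨i, rfl⟩ := h.surjective v
  set C := h.singletonColoring i with hC
  have tail : ∀ {j : ℤ}, i < j → 0 ≤ (j - i - 1) / α := fun hi =>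
    Int.ediv_nonneg (by lia) (by lia)
  have zero_iff : ∀ x, C x = 0 ↔ x = pos i := by
    intro x
    have h1 := h.le_index i x
    have h2 := h.pos_index i x
    simp only [hC, singletonColoring]
    split_ifs with h3
    · have : h.index i x = i := le_antisymm h3 h1
      rw [this] at h2
      simp [h2]
    · have := tail (not_le.1 h3)
      refine ⟨fun _ => by lia, fun h4 => ?_⟩
      rw [h4, h.index_pos le_rfl (by lia)] at h3
      lia
  have C_of_ne : ∀ x, x ≠ pos i → C x = 1 + (h.index i x - i - 1) / α ∧ i < h.index i x := by
    intro x hx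
    have h3 : ¬ h.index i x ≤ i := fun h3 => hx (by
      rw [← h.pos_index i x, le_antisymm h3 (h.le_index i x)])
    exact ⟨by simp only [hC, singletonColoring, if_neg h3], not_le.1 h3⟩
  have nonneg : ∀ x, 0 ≤ C x := by
    intro x
    by_cases hx : x = pos i
    · rw [(zero_iff x).2 hx]
    · obtain ⟨h1, h2⟩ := C_of_ne x hx
      have := tail h2
      lia
  have lt_n : ∀ x, C x < n := by
    intro x
    by_cases hx : x = pos i
    · rw [(zero_iff x).2 hx]; lia
    · obtain ⟨h1, h2⟩ := C_of_ne x hx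
      have : (h.index i x - i - 1) / α < m := by
        apply Int.ediv_lt_of_lt_mul (by lia)
        have := h.index_lt i x
        linarith
      lia
  have close : ∀ x y, C x = C y → |h.index i x - h.index i y| < α := by
    intro x y hxy
    by_cases hx : x = pos i
    · rw [(zero_iff x).2 hx] at hxy
      rw [hx, (zero_iff y).1 hxy.symm]
      simp; lia
    · by_cases hy : y = pos i
      · exact absurd ((zero_iff x).1 (hxy.trans ((zero_iff y).2 hy))) hx
      · rw [(C_of_ne x hx).1, (C_of_ne y hy).1] at hxy
        have := close_of_ediv_eq (by lia : 0 < α) (add_left_cancel hxy)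
        rw [abs_lt] at this ⊢
        constructor <;> lia
  have proper : ∀ x y, C x = C y → ¬ H.Adj x y := fun x y hxy =>
    h.not_adj_of_close (close x y hxy)
  set C' : W → ℤ := fun x => if x = u then 0 else C x with hC'
  have hu : u ≠ pos i := huv.ne
  have hCu : C u ≠ 0 := fun h0 => hu ((zero_iff u).1 h0)
  have proper' : ∀ x y, C' x = C' y → ¬ H.Adj x y := by
    intro x y hxy
    simp only [hC'] at hxy
    split_ifs at hxy with h1 h2 h2
    · rw [h1, h2]; exact H.irrefl
    · rw [(zero_iff y).1 hxy.symm, h1]; exact hadj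
    · rw [(zero_iff x).1 hxy, h2]; exact fun h => hadj h.symm
    · exact proper x y hxy
  have sums := (hg.sum_int_eq C nonneg lt_n proper).trans (hg.sum_int_eq C'
    (fun x => by simp only [hC']; split_ifs <;> [exact le_rfl; exact nonneg x])
    (fun x => by simp only [hC']; split_ifs <;> [lia; exact lt_n x]) proper').symm
  -- the class of `u` contains another vertex
  have hex : ∃ x, C x = C u ∧ x ≠ u := by
    obtain ⟨e1, e2⟩ := C_of_ne u hu
    set j := h.index i u with hj
    have hpj : pos j = u := h.pos_index i u
    have hjlt := h.index_lt i u
    rw [← hj] at hjlt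
    have d1 := Int.mul_ediv_add_emod (j - i - 1) α
    set t := (j - i - 1) / α with ht
    have r0 := Int.emod_nonneg (j - i - 1) (by lia : α ≠ 0)
    have r1 := Int.emod_lt_of_pos (j - i - 1) (by lia : 0 < α)
    have ht0 : 0 ≤ t := tail e2
    have htm : t < m := by
      apply Int.ediv_lt_of_lt_mul (by lia)
      linarith
    have hat : 0 ≤ α * t := by positivity
    have hatm : α * t + α ≤ α * m := by nlinarith
    have cand : ∀ j', i + 1 + α * t ≤ j' → j' < i + 1 + α * t + α → j' ≠ j →
        ∃ x, C x = C u ∧ x ≠ u := by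
      intro j' h1 h2 h3
      have hidx : h.index i (pos j') = j' := h.index_pos (by linarith) (by linarith)
      refine ⟨pos j', ?_, ?_⟩
      · have hne : pos j' ≠ pos i := by
          intro heq
          rw [heq, h.index_pos le_rfl (by lia)] at hidx
          linarith
        rw [(C_of_ne _ hne).1, hidx, e1]
        congr 1
        apply le_antisymm
        · exact Int.lt_add_one_iff.1 (Int.ediv_lt_of_lt_mul (by lia) (by linarith))
        · exact Int.le_ediv_of_mul_le (by lia) (by linarith)
      · intro heq
        rw [heq] at hidx
        exact h3 (hidx.symm.trans hj.symm)
    -- Since `α ≥ 2`, the block of `u` contains the next position if `u` comes first in it, and the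
    -- previous one otherwise.
    by_cases hr : (j - i - 1) % α = 0
    · exact cand (j + 1) (by linarith) (by linarith) (by lia)
    · exact cand (j - 1) (by lia) (by lia) (by lia)
  have hne : ((Finset.univ : Finset W).filter fun x => C x = C u ∧ x ≠ u).Nonempty := by
    obtain ⟨x, hx⟩ := hex
    exact ⟨x, by simpa using hx⟩
  obtain ⟨k', hk'mem, hk'min⟩ := Finset.exists_min_image _ id hne
  simp only [Finset.mem_filter, Finset.mem_univ, true_and, id] at hk'mem hk'min
  have least_k' : IsLeast {x | C' x = C u} k' := by
    refine ⟨by simp [hC', hk'mem.2, hk'mem.1], fun x hx => ?_⟩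
    simp only [Set.mem_ofPred_eq, hC'] at hx
    split_ifs at hx with h1
    · exact absurd hx.symm hCu
    · exact hk'min x ⟨hx, h1⟩
  have least_u : IsLeast {x | C' x = 0} u := by
    refine ⟨by simp [hC'], fun x hx => ?_⟩
    simp only [Set.mem_ofPred_eq, hC'] at hx
    split_ifs at hx with h1
    · exact h1.ge
    · rw [(zero_iff x).1 hx]; exact huv.le
  have least_v : IsLeast {x | C x = 0} (pos i) :=
    ⟨(zero_iff _).2 rfl, fun x hx => ((zero_iff x).1 hx).ge⟩
  have hiff : ∀ x, (C x = 0 ∨ C x = C u) ↔ (C' x = 0 ∨ C' x = C u) := by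
    intro x
    simp only [hC']
    split_ifs with h1
    · simp [h1]
    · rfl
  have hother : ∀ x, ¬ (C x = 0 ∨ C x = C u) → C' x = C x := by
    intro x hx
    have : x ≠ u := by rintro rfl; exact hx (Or.inr rfl)
    simp [hC', this]
  -- If `k' < u`, the minimum of the old block is unaffected and `g v = g u`; if `u < k'`, it passes
  -- from `u` to `k'` and `g v = g k'`.
  rcases lt_or_gt_of_ne hk'mem.2 with hlt | hlt
  · have least_k : IsLeast {x | C x = C u} k' := by
      refine ⟨hk'mem.1, fun x hx => ?_⟩
      by_cases h1 : x = u
      · exact h1 ▸ hlt.le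
      · exact hk'min x ⟨hx, h1⟩
    have := class_min_exchange sums hCu.symm hiff hother least_v least_k least_u least_k'
    refine ⟨h.index i u, h.index i k', close u k' hk'mem.1.symm, ?_, ?_⟩
    · rwa [h.pos_index, h.pos_index]
    · rw [h.pos_index]
      exact add_right_cancel this
  · have least_k : IsLeast {x | C x = C u} u := by
      refine ⟨rfl, fun x hx => ?_⟩
      by_cases h1 : x = u
      · exact h1.ge
      · exact hlt.le.trans (hk'min x ⟨hx, h1⟩)
    have := class_min_exchange sums hCu.symm hiff hother least_v least_k least_u least_k'
    refine ⟨h.index i k', h.index i u, close k' u hk'mem.1, ?_, ?_⟩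
    · rwa [h.pos_index, h.pos_index]
    · rw [h.pos_index]
      rw [add_comm (g u)] at this
      exact add_right_cancel this

theorem eq_of_not_source {n : ℕ} (hn : (n : ℤ) = m + 1) {g : W → A} {K : A}
    (hg : IsClassMinSum H n g K) {u v u' v' : W} (huv : u < v) (hadj : ¬ H.Adj u v)
    (huv' : u' < v') (hadj' : ¬ H.Adj u' v') : g v = g v' := by
  have hα := h.two_le_width
  have hlen := h.le_length
  obtain ⟨i, i', h1, h2, h3⟩ := h.exists_not_local_min hn hg huv hadj
  obtain ⟨j, j', h4, h5, h6⟩ := h.exists_not_local_min hn hg huv' hadj'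
  rw [h3, h6]
  -- Positions at distance at most `α + 1` carry distinct vertices because the cycle has length at
  -- least `2 * α + 1`.
  refine (h.cutInvariant hn hg).eq_of_not_local_min hα (fun x y hxy hyx heq => ?_) h1 h2 h4 h5
  have := Int.eq_zero_of_abs_lt_dvd ((h.eq_iff x y).1 heq) (abs_lt.2 ⟨by linarith, by linarith⟩)
  linarith

end Core

end IsCyclicArrangement

/-! ### Colourings and order of critical graphs -/

section Critical

variable {W : Type*} {H : SimpleGraph W}

theorem chromaticNumber_le_of_int_coloring {k : ℕ} (C : W → ℤ) (h0 : ∀ v, 0 ≤ C v)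
    (hk : ∀ v, C v < k) (hC : ∀ u v, H.Adj u v → C u ≠ C v) : H.chromaticNumber ≤ k := by
  refine SimpleGraph.Colorable.chromaticNumber_le ⟨SimpleGraph.Coloring.mk
    (fun v => (⟨(C v).toNat, by have := h0 v; have := hk v; lia⟩ : Fin k)) fun {u v} huv heq => ?_⟩
  rw [Fin.mk.injEq] at heq
  have := hC u v huv
  have := h0 u
  have := h0 v
  lia

/-- In a critical graph every vertex is a colour class of some optimal colouring. -/
theorem IsChiCritical.exists_coloring (hcrit : IsChiCritical H) {n : ℕ}
    (hn : H.chromaticNumber = n) (v : W) : ∃ C : W → ℕ, (∀ w, C w < n) ∧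
      (∀ u w, C u = C w → ¬ H.Adj u w) ∧ ∀ w, C w = C v → w = v := by
  classical
  have h := hcrit v
  rw [hn] at h
  obtain ⟨k, hk⟩ := ENat.ne_top_iff_exists.1 h.ne_top
  rw [← hk, Nat.cast_lt] at h
  obtain ⟨c⟩ : (H.induce ({v}ᶜ : Set W)).Colorable k :=
    SimpleGraph.chromaticNumber_le_iff_colorable.1 hk.ge
  have hmem : ∀ {w}, w ≠ v → w ∈ ({v}ᶜ : Set W) := fun hw => hw
  set C : W → ℕ := fun w => if hw : w = v then k else c ⟨w, hmem hw⟩ with hC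
  have hCv : C v = k := by simp [hC]
  have hCw : ∀ {w} (hw : w ≠ v), C w = c ⟨w, hmem hw⟩ := fun hw => by simp [hC, hw]
  have hlt : ∀ {w}, w ≠ v → C w < k := fun hw => by rw [hCw hw]; exact Fin.is_lt _
  refine ⟨C, fun w => ?_, fun u w huw hadj => ?_, fun w hw => ?_⟩
  · by_cases hw : w = v
    · rwa [hw, hCv]
    · exact (hlt hw).trans h
  · by_cases hu : u = v
    · by_cases hw : w = v
      · exact hadj.ne (hu.trans hw.symm)
      · have := hlt hw
        rw [← huw, hu, hCv] at this
        exact lt_irrefl _ this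
    · by_cases hw : w = v
      · have := hlt hu
        rw [huw, hw, hCv] at this
        exact lt_irrefl _ this
      · rw [hCw hu, hCw hw] at huw
        exact c.valid (v := ⟨u, hmem hu⟩) (w := ⟨w, hmem hw⟩) hadj (Fin.ext huw)
  · by_contra hne
    have := hlt hne
    rw [hw, hCv] at this
    exact lt_irrefl _ this

/-- An optimal colouring with a singleton class leaves `n - 1` stable sets for the other vertices,
so `|W| - 1 ≤ a * (n - 1)`. The bound `χ ≤ ⌈|W| / a⌉` gives the reverse inequality. -/
theorem IsChiCritical.card_eq [Fintype W] [Nonempty W] (hcrit : IsChiCritical H) {n a : ℕ}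
    (hn : H.chromaticNumber = n)
    (hstable : ∀ s : Finset W, (∀ u ∈ s, ∀ v ∈ s, ¬ H.Adj u v) → s.card ≤ a)
    (hcol : H.chromaticNumber ≤ ((Fintype.card W - 1) / a + 1 : ℕ)) :
    Fintype.card W = a * (n - 1) + 1 := by
  classical
  obtain ⟨v⟩ := ‹Nonempty W›
  obtain ⟨C, hlt, hC, hv⟩ := hcrit.exists_coloring hn v
  have h1 : (Finset.univ.erase v).card ≤ a * ((Finset.range n).erase (C v)).card := by
    refine Finset.card_le_mul_card_image_of_maps_to (f := C) (fun w hw => ?_) a (fun c _ => ?_)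
    · rw [Finset.mem_erase, Finset.mem_range]
      exact ⟨fun h => (Finset.ne_of_mem_erase hw) (hv w h), hlt w⟩
    · refine hstable _ fun u hu w hw => hC u w ?_
      rw [Finset.mem_filter] at hu hw
      exact hu.2.trans hw.2.symm
  rw [Finset.card_erase_of_mem (Finset.mem_univ _), Finset.card_univ,
    Finset.card_erase_of_mem (Finset.mem_range.2 (hlt v)), Finset.card_range] at h1
  rw [hn, Nat.cast_le] at hcol
  have h2 : a * (n - 1) ≤ Fintype.card W - 1 :=
    (Nat.mul_le_mul_left a (by lia)).trans (Nat.mul_div_le _ a)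
  have : 0 < Fintype.card W := Fintype.card_pos_iff.2 ⟨v⟩
  lia

end Critical

/-! ### Webs and antiwebs -/

section Circulant

variable {W : Type*} {q : ℕ} {val : W → ℤ}

theorem exists_position (h0 : ∀ w, 0 ≤ val w) (hq : ∀ w, val w < q)
    (hinj : Function.Injective val) (hsurj : ∀ i : ℤ, 0 ≤ i → i < q → ∃ w, val w = i) {t : ℤ}
    (hq0 : 0 < q) (ht : IsCoprime t q) : ∃ pos : ℤ → W, (∀ i, val (pos i) = (t * i) % q) ∧
      (∀ i j, pos i = pos j ↔ (q : ℤ) ∣ i - j) ∧ Function.Surjective pos := by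
  have hq' : (0 : ℤ) < q := by exact_mod_cast hq0
  choose pos hpos using fun i : ℤ => hsurj ((t * i) % q) (Int.emod_nonneg _ hq'.ne')
    (Int.emod_lt_of_pos _ hq')
  refine ⟨pos, hpos, fun i j => ?_, fun w => ?_⟩
  · rw [← hinj.eq_iff, hpos, hpos, Int.emod_eq_emod_iff_emod_sub_eq_zero,
      ← Int.dvd_iff_emod_eq_zero, ← mul_sub]
    exact ⟨fun h => ht.symm.dvd_of_dvd_mul_left h, fun h => h.mul_left t⟩
  · obtain ⟨a, b, hab⟩ := ht
    refine ⟨a * val w, hinj ?_⟩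
    rw [hpos, ← Int.emod_eq_of_lt (h0 w) (hq w), Int.emod_eq_emod_iff_emod_sub_eq_zero,
      ← Int.dvd_iff_emod_eq_zero, Int.emod_eq_of_lt (h0 w) (hq w)]
    exact ⟨-(b * val w), by linear_combination val w * hab⟩

theorem emod_sub_emod_eq {q x y : ℤ} (h1 : 0 < y - x) (h2 : y - x < q) :
    y % q - x % q = y - x ∨ y % q - x % q = y - x - q := by
  have hq : 0 < q := h1.trans h2
  have hx := Int.mul_ediv_add_emod x q
  have hy := Int.mul_ediv_add_emod y q
  have := Int.emod_nonneg x hq.ne'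
  have := Int.emod_nonneg y hq.ne'
  have := Int.emod_lt_of_pos x hq
  have := Int.emod_lt_of_pos y hq
  have l1 : y / q < x / q + 2 := by
    by_contra h
    have : q * (x / q + 2) ≤ q * (y / q) := mul_le_mul_of_nonneg_left (not_lt.1 h) hq.le
    linarith
  have l2 : x / q < y / q + 1 := by
    by_contra h
    have : q * (y / q + 1) ≤ q * (x / q) := mul_le_mul_of_nonneg_left (not_lt.1 h) hq.le
    linarith
  rcases (by lia : y / q = x / q ∨ y / q = x / q + 1) with h | h
  · left; rw [h] at hy; linarith
  · right; rw [h] at hy; linarith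

variable {H : SimpleGraph W} {l : ℕ}

/-- Offsets from the least element lie in `[0, l)` or above `q - l`. Shifting the latter down by `q
- l` lands in `[0, l)`, and a collision would be a pair at distance exactly `q - l`, which is an
edge. -/
theorem web_stable_card_le (hl : 1 ≤ l) (hlq : 2 * l ≤ q) (hq : ∀ w, val w < q)
    (h0 : ∀ w, 0 ≤ val w) (hinj : Function.Injective val)
    (hadj : ∀ u v, H.Adj u v ↔ u ≠ v ∧ (l : ℤ) ≤ |val u - val v| ∧ |val u - val v| ≤ q - l)
    (s : Finset W) (hs : ∀ u ∈ s, ∀ v ∈ s, ¬ H.Adj u v) : s.card ≤ l := by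
  rcases s.eq_empty_or_nonempty with rfl | hne
  · simp
  obtain ⟨x, hx, hmin⟩ := Finset.exists_min_image s val hne
  have key : ∀ u ∈ s, ∀ v ∈ s, |val u - val v| < l ∨ (q : ℤ) - l < |val u - val v| := by
    intro u hu v hv
    by_cases huv : u = v
    · subst huv; left; simp; lia
    · have := hs u hu v hv
      rw [hadj] at this
      by_contra hcon
      push Not at hcon
      exact this ⟨huv, hcon⟩
  have := Finset.card_le_card_of_injOn (s := s) (t := Finset.Ico (0 : ℤ) l)
    (fun y => if val y - val x < l then val y - val x else val y - val x - (q - l))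
    (fun y hy => by
      have h1 := hmin y hy
      have h2 := key y hy x hx
      have := hq y
      have := h0 x
      rw [Finset.coe_Ico, Set.mem_Ico]
      rw [abs_of_nonneg (by lia)] at h2
      beta_reduce
      split_ifs <;> lia)
    (fun y hy z hz hyz => by
      have h1 := hmin y hy
      have h2 := hmin z hz
      have h3 := key y hy z hz
      apply hinj
      simp only at hyz
      split_ifs at hyz with h4 h5 h5
      · lia
      · rw [abs_sub_comm, abs_of_nonneg (by lia)] at h3; lia
      · rw [abs_of_nonneg (by lia)] at h3; lia
      · lia)
  simpa using this

/-- Elements are at distance at least `l`, so each block of `l` offsets contains at most one;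
offsets are at most `q - l`, which leaves `q / l` blocks. -/
theorem antiweb_stable_card_le (hl : 1 ≤ l) (hlq : 2 * l ≤ q)
    (hadj : ∀ u v, ¬ H.Adj u v ↔ u = v ∨ ((l : ℤ) ≤ |val u - val v| ∧ |val u - val v| ≤ q - l))
    (s : Finset W) (hs : ∀ u ∈ s, ∀ v ∈ s, ¬ H.Adj u v) : s.card ≤ q / l := by
  rcases s.eq_empty_or_nonempty with rfl | hne
  · simp
  have hl' : (0 : ℤ) < l := by exact_mod_cast hl
  obtain ⟨x, hx, hmin⟩ := Finset.exists_min_image s val hne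
  have hmap : ∀ y ∈ s, (val y - val x) / l < (q / l : ℕ) := by
    intro y hy
    have h1 := hmin y hy
    have h2 := (hadj y x).1 (hs y hy x hx)
    have h3 : val y - val x ≤ q - l := by
      rcases h2 with rfl | h2
      · simp; lia
      · exact (le_abs_self _).trans h2.2
    have h4 : (val y - val x) / l + 1 ≤ q / l := by
      have h5 : (val y - val x) / l + 1 = (val y - val x + l * 1) / l :=
        (Int.add_mul_ediv_left _ _ hl'.ne').symm
      rw [h5]
      exact Int.ediv_le_ediv hl' (by linarith)
    push_cast
    lia
  have := Finset.card_le_card_of_injOn (s := s) (t := Finset.Ico (0 : ℤ) (q / l : ℕ))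
    (fun y => (val y - val x) / l)
    (fun y hy => by
      rw [Finset.coe_Ico, Set.mem_Ico]
      exact ⟨Int.ediv_nonneg (by have := hmin y hy; lia) hl'.le, hmap y hy⟩)
    (fun y hy z hz hyz => by
      have h1 := IsCyclicArrangement.close_of_ediv_eq hl' hyz
      rw [sub_sub_sub_cancel_right] at h1
      rcases (hadj y z).1 (hs y hy z hz) with h2 | h2
      · exact h2
      · exact absurd h2.1 h1.not_ge)
  rwa [Int.card_Ico, sub_zero, Int.toNat_natCast] at this

theorem web_chromaticNumber_le (hl : 1 ≤ l) (hq : ∀ w, val w < q) (h0 : ∀ w, 0 ≤ val w)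
    (hadj : ∀ u v, H.Adj u v ↔ u ≠ v ∧ (l : ℤ) ≤ |val u - val v| ∧ |val u - val v| ≤ q - l) :
    H.chromaticNumber ≤ ((q - 1) / l + 1 : ℕ) := by
  have hl' : (0 : ℤ) < l := by exact_mod_cast hl
  refine chromaticNumber_le_of_int_coloring (fun v => val v / l)
    (fun v => Int.ediv_nonneg (h0 v) hl'.le) (fun v => ?_) (fun u v huv heq => ?_)
  · have := hq v
    have := h0 v
    have : val v / l ≤ ((q - 1 : ℕ) : ℤ) / l := Int.ediv_le_ediv hl' (by lia)
    push_cast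
    lia
  · exact absurd ((hadj u v).1 huv).2.1 (IsCyclicArrangement.close_of_ediv_eq hl' heq).not_ge

/-- Cut `[0, q)` into `k = q / l` nearly equal arcs, starting at `⌊a * q / k⌋`, with lengths between
`l` and `⌈q / k⌉`, and colour each vertex by its offset in its arc. Equal offsets in different arcs
are at cyclic distance at least `l`. -/
theorem antiweb_chromaticNumber_le (hl : 1 ≤ l) (hlq : 2 * l ≤ q) (hq : ∀ w, val w < q)
    (h0 : ∀ w, 0 ≤ val w) (hinj : Function.Injective val)
    (hadj : ∀ u v, ¬ H.Adj u v ↔ u = v ∨ ((l : ℤ) ≤ |val u - val v| ∧ |val u - val v| ≤ q - l)) :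
    H.chromaticNumber ≤ ((q - 1) / (q / l) + 1 : ℕ) := by
  have hkpos : 0 < q / l := Nat.div_pos (by lia) hl
  have hkl : (q / l) * l ≤ q := Nat.div_mul_le_self q l
  set k := q / l
  have hk : (0 : ℤ) < k := by exact_mod_cast hkpos
  have hql : (k : ℤ) * l ≤ q := by exact_mod_cast hkl
  have hc : (q : ℤ) ≤ k * (((q - 1) / k + 1 : ℕ) : ℤ) := by
    have h1 := Nat.lt_mul_div_succ (q - 1) hkpos
    have h2 : q ≤ k * ((q - 1) / k + 1) := by lia
    exact_mod_cast h2
  set c := (q - 1) / k + 1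
  set f : ℤ → ℤ := fun a => a * q / k with hf
  have fmono : ∀ {a b}, a ≤ b → f a ≤ f b := fun hab =>
    Int.ediv_le_ediv hk (mul_le_mul_of_nonneg_right hab (by positivity))
  have fsucc : ∀ a, f a + l ≤ f (a + 1) := by
    intro a
    rw [hf]
    simp only
    rw [← Int.add_mul_ediv_left _ _ hk.ne']
    exact Int.ediv_le_ediv hk (by linarith)
  have fsucc' : ∀ a, f (a + 1) ≤ f a + c := by
    intro a
    rw [hf]
    simp only
    rw [← Int.add_mul_ediv_left _ _ hk.ne']
    exact Int.ediv_le_ediv hk (by linarith)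
  have fk : f k = q := by
    simp only [hf]
    exact Int.mul_ediv_cancel_left _ hk.ne'
  have fzero : f 0 = 0 := by simp [hf]
  have hex : ∀ w, ∃ a : ℤ, 0 ≤ a ∧ a + 1 ≤ k ∧ f a ≤ val w ∧ val w < f (a + 1) := by
    intro w
    have h1 := h0 w
    have h2 := hq w
    have hq' : (0 : ℤ) < q := h1.trans_lt h2
    have e1 := Int.mul_ediv_add_emod ((val w + 1) * k - 1) q
    have e2 := Int.emod_nonneg ((val w + 1) * k - 1) hq'.ne'
    have e3 := Int.emod_lt_of_pos ((val w + 1) * k - 1) hq'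
    -- This is the largest `a` with `a * q < (val w + 1) * k`, that is, with `f a ≤ val w`.
    refine ⟨((val w + 1) * k - 1) / q, Int.ediv_nonneg (by nlinarith) hq'.le, ?_, ?_, ?_⟩
    · exact Int.add_one_le_iff.2 (Int.ediv_lt_of_lt_mul hq' (by nlinarith))
    · exact Int.lt_add_one_iff.1 (Int.ediv_lt_of_lt_mul hk (by linarith))
    · exact Int.lt_of_add_one_le (Int.le_ediv_of_mul_le hk (by linarith))
  choose a ha0 hak hfa hfa' using hex
  have sep : ∀ u v, val u - f (a u) = val v - f (a v) → a u < a v → ¬ H.Adj u v := by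
    intro u v huv hlt
    rw [hadj]
    right
    have h1 := fmono (Int.add_one_le_iff.2 hlt)
    have h2 := fsucc (a u)
    have h3 := fsucc (a v)
    have h4 := fmono (hak v)
    have h5 := fmono (ha0 u)
    rw [abs_sub_comm, abs_of_nonneg (by lia)]
    constructor <;> lia
  refine chromaticNumber_le_of_int_coloring (fun v => val v - f (a v)) (fun v => ?_) (fun v => ?_)
    (fun u v huv heq => ?_)
  · have := hfa v
    lia
  · have := hfa' v
    have := fsucc' (a v)
    lia
  · rcases lt_trichotomy (a u) (a v) with hlt | he | hlt
    · exact sep u v heq hlt huv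
    · simp only [he] at heq
      exact huv.ne (hinj (by lia))
    · exact sep v u heq.symm hlt huv.symm

theorem exists_web_arrangement [Fintype W] (hl : 2 ≤ l) (hlq : 2 * l ≤ q)
    (hcard : Fintype.card W = q) (hq : ∀ w, val w < q) (h0 : ∀ w, 0 ≤ val w)
    (hinj : Function.Injective val) (hsurj : ∀ i : ℤ, 0 ≤ i → i < q → ∃ w, val w = i)
    (hadj : ∀ u v, H.Adj u v ↔ u ≠ v ∧ (l : ℤ) ≤ |val u - val v| ∧ |val u - val v| ≤ q - l)
    (hcrit : IsChiCritical H) {n : ℕ} (hn : H.chromaticNumber = n) :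
    ∃ α m pos, IsCyclicArrangement H α m pos ∧ (n : ℤ) = m + 1 ∧
      (Fintype.card W : ℤ) = α * m + 1 := by
  have : Nonempty W := Fintype.card_pos_iff.1 (by lia)
  have hc := hcrit.card_eq hn (web_stable_card_le (by lia) hlq hq h0 hinj hadj)
    (hcard ▸ web_chromaticNumber_le (by lia) hq h0 hadj)
  have hm : 2 ≤ n - 1 := by
    by_contra hcon
    have : l * (n - 1) ≤ l * 1 := Nat.mul_le_mul_left l (by lia)
    lia
  -- The natural cyclic order works for a web, with `α = l`.
  obtain ⟨pos, hval, hpos, hps⟩ := exists_position h0 hq hinj hsurj (t := 1) (by lia)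
    isCoprime_one_left
  have hqe : (q : ℤ) = l * (n - 1 : ℕ) + 1 := by rw [← hcard, hc]; push_cast; ring
  refine ⟨l, (n - 1 : ℕ), pos, ⟨by lia, by lia, by rwa [← hqe], hps, fun i j hij hji => ?_⟩,
    by lia, by rw [hcard, hqe]⟩
  rw [hadj, hval, hval, one_mul, one_mul, abs_sub_comm]
  rintro ⟨-, h1, h2⟩
  rcases emod_sub_emod_eq (q := q) (x := i) (y := j) (by lia) (by lia) with h | h
  · rw [h, abs_of_nonneg (by lia)] at h1
    lia
  · rw [h, abs_of_nonpos (by lia)] at h2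
    lia

theorem exists_antiweb_arrangement [Fintype W] (hl : 2 ≤ l) (hlq : 2 * l ≤ q)
    (hcard : Fintype.card W = q) (hq : ∀ w, val w < q) (h0 : ∀ w, 0 ≤ val w)
    (hinj : Function.Injective val) (hsurj : ∀ i : ℤ, 0 ≤ i → i < q → ∃ w, val w = i)
    (hadj : ∀ u v, ¬ H.Adj u v ↔ u = v ∨ ((l : ℤ) ≤ |val u - val v| ∧ |val u - val v| ≤ q - l))
    (hcrit : IsChiCritical H) {n : ℕ} (hn : H.chromaticNumber = n) :
    ∃ α m pos, IsCyclicArrangement H α m pos ∧ (n : ℤ) = m + 1 ∧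
      (Fintype.card W : ℤ) = α * m + 1 := by
  have : Nonempty W := Fintype.card_pos_iff.1 (by lia)
  have hk2 : 2 ≤ q / l := (Nat.le_div_iff_mul_le (by lia)).2 hlq
  have hkl : (q / l) * l ≤ q := Nat.div_mul_le_self q l
  have hc := hcrit.card_eq hn (antiweb_stable_card_le (by lia) hlq hadj)
    (by rw [hcard]; exact antiweb_chromaticNumber_le (by lia) hlq hq h0 hinj hadj)
  set k := q / l
  rw [hcard] at hc
  -- If `n ≤ l`, then `k * n ≤ k * l ≤ q = k * (n - 1) + 1` would force `k ≤ 1`.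
  have hlm : l ≤ n - 1 := by
    by_contra hcon
    have : k * (n - 1 + 1) ≤ k * l := Nat.mul_le_mul_left k (by lia)
    rw [mul_add] at this
    lia
  have hqe : (q : ℤ) = k * (n - 1 : ℕ) + 1 := by rw [hc]; push_cast; ring
  -- Walk around in steps of `n - 1`, which is prime to `q = k * (n - 1) + 1`. Fewer than `k` steps
  -- move by at least `n - 1 ≥ l` and at most `(k - 1) * (n - 1) = q - n ≤ q - l`.
  obtain ⟨pos, hval, hpos, hps⟩ := exists_position h0 hq hinj hsurj (t := (n - 1 : ℕ)) (by lia)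
    ⟨-k, 1, by rw [hqe]; ring⟩
  refine ⟨k, (n - 1 : ℕ), pos, ⟨by lia, by lia, by rwa [← hqe], hps, fun i j hij hji => ?_⟩,
    by lia, by rw [hcard, hqe]⟩
  rw [hadj, hval, hval, abs_sub_comm]
  right
  have b1 : ((n - 1 : ℕ) : ℤ) * 1 ≤ (n - 1 : ℕ) * (j - i) :=
    mul_le_mul_of_nonneg_left (by lia) (by positivity)
  have b2 : ((n - 1 : ℕ) : ℤ) * (j - i) ≤ (n - 1 : ℕ) * (k - 1) :=
    mul_le_mul_of_nonneg_left (by lia) (by positivity)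
  have b3 : ((n - 1 : ℕ) : ℤ) * (k - 1) = q - 1 - (n - 1 : ℕ) := by rw [hqe]; ring
  have b4 : (l : ℤ) ≤ (n - 1 : ℕ) := by exact_mod_cast hlm
  have b5 : ((n - 1 : ℕ) : ℤ) * (j - i) = (n - 1 : ℕ) * j - (n - 1 : ℕ) * i := by ring
  have hl0 : (2 : ℤ) ≤ l := by exact_mod_cast hl
  rcases emod_sub_emod_eq (q := q) (x := (n - 1 : ℕ) * i) (y := (n - 1 : ℕ) * j) (by linarith)
    (by linarith) with h | h
  · rw [h, abs_of_nonneg (by linarith)]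
    constructor <;> linarith
  · rw [h, abs_of_nonpos (by linarith)]
    constructor <;> linarith

/-- A critical web or antiweb has a cyclic arrangement. -/
theorem IsChiCritical.exists_arrangement [Fintype W] (hcrit : IsChiCritical H)
    (hweb : IsWeb H ∨ IsAntiweb H) {n : ℕ} (hn : H.chromaticNumber = n) :
    ∃ α m pos, IsCyclicArrangement H α m pos ∧ (n : ℤ) = m + 1 ∧
      (Fintype.card W : ℤ) = α * m + 1 := by
  rcases hweb with ⟨q, l, hl, hlq, ⟨e⟩⟩ | ⟨q, l, hl, hlq, ⟨e⟩⟩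
  all_goals
    have hcard : Fintype.card W = q := by rw [Fintype.card_congr e.toEquiv, Fintype.card_fin]
    have hinj : Function.Injective fun w => ((e w : ℕ) : ℤ) := fun u v huv =>
      e.injective (Fin.ext (Int.ofNat_inj.1 huv))
    have hsurj : ∀ i : ℤ, 0 ≤ i → i < q → ∃ w, ((e w : ℕ) : ℤ) = i := fun i h0 h1 =>
      ⟨e.symm ⟨i.toNat, by lia⟩, by simp [h0]⟩
  · refine exists_web_arrangement hl hlq hcard (fun w => by have := (e w).isLt; lia)
      (fun w => by lia) hinj hsurj (fun u v => ?_) hcrit hn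
    rw [← e.map_adj_iff, ← e.injective.ne_iff]
    rfl
  · refine exists_antiweb_arrangement hl hlq hcard (fun w => by have := (e w).isLt; lia)
      (fun w => by lia) hinj hsurj (fun u v => ?_) hcrit hn
    rw [← e.map_adj_iff, SimpleGraph.compl_adj, ← e.injective.eq_iff]
    simp only [webGraph]
    tauto

end Circulant

/-! ### Validity in the representatives formulation -/

namespace RepForm

variable {V : Type*} [Fintype V] [LinearOrder V] {G : SimpleGraph V}

theorem mem_antiNeg {u v : V} : u ∈ antiNeg G v ↔ u < v ∧ ¬ G.Adj u v := by
  simp [antiNeg]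

theorem mem_antiPos {u v : V} : u ∈ antiPos G v ↔ v ∈ antiNeg G u := by
  simp [antiNeg, antiPos, G.adj_comm]

theorem mem_sourcesIn {U : Finset V} {v : V} :
    v ∈ sourcesIn G U ↔ v ∈ U ∧ ∀ u ∈ U, u ∉ antiNeg G v := by
  simp only [sourcesIn, Finset.mem_filter, Finset.eq_empty_iff_forall_notMem, Finset.mem_inter]
  exact and_congr_right fun _ => ⟨fun h u hu hv => h u ⟨hv, hu⟩, fun h u hu => h u hu.2 hu.1⟩

theorem mem_sdiff_sourcesIn {U : Finset V} {v : V} :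
    v ∈ U \ sourcesIn G U ↔ v ∈ U ∧ ∃ u ∈ U, u ∈ antiNeg G v := by
  rw [Finset.mem_sdiff, mem_sourcesIn]
  push Not
  exact ⟨fun h => ⟨h.1, h.2 h.1⟩, fun h => ⟨h.1, fun _ => h.2⟩⟩

theorem not_isSource_of_mem {u v : V} (h : u ∈ antiNeg G v) : ¬ IsSource G v := fun hs => by
  rw [IsSource] at hs
  simp [hs] at h

theorem coord_apply_of {u v : V} (h : u ∈ antiNeg G v ∨ (u = v ∧ ¬ IsSource G v))
    (x : Var G → ℝ) : coord G u v x = x ⟨(u, v), h⟩ := by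
  simp [coord, h]

theorem coord_apply_of_not {u v : V} (h : ¬ (u ∈ antiNeg G v ∨ (u = v ∧ ¬ IsSource G v)))
    (x : Var G → ℝ) : coord G u v x = 0 := by
  simp [coord, h]

theorem internalLHS_apply (U : Finset V) (z : ℝ × (Var G → ℝ)) :
    internalLHS G U z =
      ∑ v ∈ U \ sourcesIn G U, ∑ u ∈ insert v (antiNeg G v \ U), coord G u v z.2 := by
  simp [internalLHS]

section Validity

variable {p : V → ℕ} {z : ℝ × (Var G → ℝ)} (hz : z ∈ feasiblePoints G p)

include hz

theorem coord_eq_zero_or_one (u v : V) : coord G u v z.2 = 0 ∨ coord G u v z.2 = 1 := by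
  by_cases h : u ∈ antiNeg G v ∨ (u = v ∧ ¬ IsSource G v)
  · rw [coord_apply_of h]
    exact hz.2.1 _
  · exact Or.inl (coord_apply_of_not h _)

theorem coord_nonneg (u v : V) : 0 ≤ coord G u v z.2 := by
  rcases coord_eq_zero_or_one hz u v with h | h <;> simp [h]

theorem repVal_le_one (v : V) : repVal G z.2 v ≤ 1 := by
  unfold repVal
  split_ifs
  · exact le_rfl
  · rcases coord_eq_zero_or_one hz v v with h | h <;> simp [h]

theorem coord_add_coord_le {u v w : V} (hv : v ∈ antiPos G u) (hw : w ∈ antiPos G u)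
    (hadj : G.Adj v w) : coord G u v z.2 + coord G u w z.2 ≤ repVal G z.2 u := by
  classical
  have := hz.2.2.2.1 u {v, w} ⟨by simp [Finset.insert_subset_iff, hv, hw],
    by simpa [SimpleGraph.isClique_pair] using fun _ => hadj,
    Or.inl (Finset.card_pair hadj.ne)⟩
  rwa [Finset.sum_pair hadj.ne] at this

/-- If `v` has a neighbour in `antiPos G u`, the clique constraint of that edge implies the bound;
otherwise `{v}` is a maximal clique with its own constraint. -/
theorem coord_le_repVal {u v : V} (hv : v ∈ antiPos G u) :
    coord G u v z.2 ≤ repVal G z.2 u := by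
  classical
  by_cases h : ∃ w ∈ antiPos G u, G.Adj v w
  · obtain ⟨w, hw, hadj⟩ := h
    linarith [coord_add_coord_le hz hv hw hadj, coord_nonneg hz u w]
  · push Not at h
    have := hz.2.2.2.1 u {v} ⟨by simp [hv], by simp, Or.inr ⟨by simp, fun K hK hc hvK => ?_⟩⟩
    · simpa using this
    · rw [Finset.singleton_subset_iff] at hvK
      refine Finset.eq_singleton_iff_unique_mem.2 ⟨hvK, fun w hw => ?_⟩
      by_contra hne
      exact h w (hK hw) (hc hvK hw (Ne.symm hne))

/-- The inequality is valid at the feasible points. -/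
theorem le_internalLHS {U : Finset V} {n : ℕ}
    (hn : (G.induce (U : Set V)).chromaticNumber = n) :
    (n : ℝ) - ((sourcesIn G U).card : ℝ) ≤ internalLHS G U z := by
  classical
  set S := sourcesIn G U with hS
  -- `R` collects the vertices contributing at least 1 to the left-hand side. A vertex outside `S ∪
  -- R` is covered by some `u` in `U`, and `u` is in `S` or has `x_{uu} = 1`; hence `S ∪ R` suffices
  -- as a set of colours.
  set R := (U \ S).filter fun v => ∃ u ∈ insert v (antiNeg G v \ U), coord G u v z.2 = 1 with hR
  have hex : ∀ v : (U : Set V), ∃ c, c ∈ S ∪ R ∧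
      (c = v ∨ ((v : V) ∈ antiPos G c ∧ coord G c v z.2 = 1)) := by
    rintro ⟨v, hv⟩
    rw [Finset.mem_coe] at hv
    by_cases hvSR : v ∈ S ∪ R
    · exact ⟨v, hvSR, Or.inl rfl⟩
    rw [Finset.mem_union, not_or] at hvSR
    have hvUS : v ∈ U \ S := Finset.mem_sdiff.2 ⟨hv, hvSR.1⟩
    have hvR : ∀ u ∈ insert v (antiNeg G v \ U), coord G u v z.2 ≠ 1 := fun u hu h =>
      hvSR.2 (Finset.mem_filter.2 ⟨hvUS, u, hu, h⟩)
    obtain ⟨-, u₀, -, hu₀⟩ := mem_sdiff_sourcesIn.1 hvUS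
    have hcov := hz.2.2.1 v (not_isSource_of_mem hu₀)
    obtain ⟨u, hu, hu1⟩ := Finset.exists_ne_zero_of_sum_ne_zero (zero_lt_one.trans_le hcov).ne'
    have hu1 : coord G u v z.2 = 1 := (coord_eq_zero_or_one hz u v).resolve_left hu1
    have huv : u ≠ v := by
      rintro rfl
      exact hvR u (Finset.mem_insert_self _ _) hu1
    have huN : u ∈ antiNeg G v := (Finset.mem_insert.1 hu).resolve_left huv
    have huU : u ∈ U := by
      by_contra h
      exact hvR u (Finset.mem_insert_of_mem (Finset.mem_sdiff.2 ⟨huN, h⟩)) hu1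
    refine ⟨u, ?_, Or.inr ⟨mem_antiPos.2 huN, hu1⟩⟩
    rw [Finset.mem_union]
    by_cases huS : u ∈ S
    · exact Or.inl huS
    refine Or.inr ?_
    have huUS : u ∈ U \ S := Finset.mem_sdiff.2 ⟨huU, huS⟩
    obtain ⟨-, u₁, -, hu₁⟩ := mem_sdiff_sourcesIn.1 huUS
    have hle := coord_le_repVal hz (mem_antiPos.2 huN)
    rw [hu1, repVal, if_neg (not_isSource_of_mem hu₁)] at hle
    refine Finset.mem_filter.2 ⟨huUS, u, Finset.mem_insert_self _ _, ?_⟩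
    rcases coord_eq_zero_or_one hz u u with h | h
    · rw [h] at hle; linarith
    · exact h
  choose c hcmem hc using hex
  have hcol : (G.induce (U : Set V)).Colorable (Fintype.card (S ∪ R : Finset V)) := by
    refine SimpleGraph.Coloring.colorable (α := (S ∪ R : Finset V))
      (SimpleGraph.Coloring.mk (fun v => ⟨c v, hcmem v⟩) fun {v w} hadj heq => ?_)
    have heq : c v = c w := congrArg Subtype.val heq
    have hadj : G.Adj v w := hadj
    rcases hc v with hv | ⟨hv, hv1⟩ <;> rcases hc w with hw | ⟨hw, hw1⟩
    · exact hadj.ne (hv.symm.trans (heq.trans hw))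
    · rw [← heq, hv, mem_antiPos, mem_antiNeg] at hw
      exact hw.2 hadj
    · rw [heq, hw, mem_antiPos, mem_antiNeg] at hv
      exact hv.2 hadj.symm
    · rw [← heq] at hw hw1
      linarith [coord_add_coord_le hz hv hw hadj, repVal_le_one hz (c v)]
  have h1 : n ≤ S.card + R.card := by
    have := hcol.chromaticNumber_le
    rw [hn, Nat.cast_le, Fintype.card_coe] at this
    exact this.trans (Finset.card_union_le _ _)
  have h2 : (R.card : ℝ) ≤ internalLHS G U z := by
    rw [internalLHS_apply, Finset.card_eq_sum_ones, Nat.cast_sum, hR, Finset.sum_filter]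
    refine Finset.sum_le_sum fun v _ => ?_
    split_ifs with h
    · obtain ⟨u, hu, hu1⟩ := h
      rw [Nat.cast_one, ← hu1]
      exact Finset.single_le_sum (f := fun u => coord G u v z.2)
        (fun u _ => coord_nonneg hz u v) hu
    · exact Finset.sum_nonneg fun u _ => coord_nonneg hz u v
  have h3 : (n : ℝ) ≤ S.card + R.card := by exact_mod_cast h1
  linarith

end Validity

/-! ### Feasible points from colourings -/

section Points

open Classical in
/-- The 0/1 point with `x_{uv} = 1` iff `Q u v`. -/
noncomputable def indPoint (G : SimpleGraph V) (Q : V → V → Prop) : Var G → ℝ :=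
  fun e => if Q e.1.1 e.1.2 then 1 else 0

/-- The unit vector of the variable `x_{uv}` (zero if there is no such variable). -/
noncomputable def unitVec (G : SimpleGraph V) (u v : V) : Var G → ℝ :=
  indPoint G fun a b => a = u ∧ b = v

open Classical in
theorem coord_indPoint (Q : V → V → Prop) (u v : V) : coord G u v (indPoint G Q) =
    if (u ∈ antiNeg G v ∨ (u = v ∧ ¬ IsSource G v)) ∧ Q u v then 1 else 0 := by
  by_cases h : u ∈ antiNeg G v ∨ (u = v ∧ ¬ IsSource G v)
  · rw [coord_apply_of h]
    simp [indPoint, h]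
  · rw [coord_apply_of_not h]
    simp [h]

theorem coord_indPoint_nonneg (Q : V → V → Prop) (u v : V) :
    0 ≤ coord G u v (indPoint G Q) := by
  classical
  rw [coord_indPoint]
  split_ifs <;> simp

theorem coord_indPoint_le_one (Q : V → V → Prop) (u v : V) :
    coord G u v (indPoint G Q) ≤ 1 := by
  classical
  rw [coord_indPoint]
  split_ifs <;> simp

/-- The bound on `y` makes every load constraint automatic, leaving only the combinatorial
conditions. -/
theorem indPoint_mem_feasiblePoints {p : V → ℕ} {Q : V → V → Prop} {y : ℝ}
    (hy : ∑ v, (p v : ℝ) ≤ y)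
    (hcov : ∀ v, ¬ IsSource G v → ∃ u, (u = v ∨ u ∈ antiNeg G v) ∧ Q u v)
    (hrep : ∀ v u, u ∈ antiPos G v → Q v u → Q v v)
    (hstable : ∀ v u w, u ∈ antiPos G v → w ∈ antiPos G v → Q v u → Q v w → ¬ G.Adj u w) :
    (y, indPoint G Q) ∈ feasiblePoints G p := by
  classical
  have hrep0 : ∀ v, 0 ≤ repVal G (indPoint G Q) v := by
    intro v
    unfold repVal
    split_ifs
    · exact zero_le_one
    · exact coord_indPoint_nonneg _ _ _
  have hrep1 : ∀ v, repVal G (indPoint G Q) v ≤ 1 := by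
    intro v
    unfold repVal
    split_ifs
    · exact le_rfl
    · exact coord_indPoint_le_one _ _ _
  refine ⟨(Finset.sum_nonneg fun v _ => by positivity).trans hy, fun e => ?_, fun v hv => ?_,
    fun v K hK => ?_, fun v => ?_⟩
  · simp only [indPoint]
    split_ifs <;> simp
  · obtain ⟨u, hu, hQ⟩ := hcov v hv
    have hone : coord G u v (indPoint G Q) = 1 := by
      rw [coord_indPoint, if_pos]
      refine ⟨?_, hQ⟩
      rcases hu with rfl | hu
      · exact Or.inr ⟨rfl, hv⟩
      · exact Or.inl hu
    rw [← hone]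
    exact Finset.single_le_sum (f := fun u => coord G u v (indPoint G Q))
      (fun u _ => coord_indPoint_nonneg _ _ _) (Finset.mem_insert.2 hu)
  · obtain ⟨hKsub, hKc, -⟩ := hK
    by_cases h : ∃ u ∈ K, Q v u
    · obtain ⟨u, hu, hQ⟩ := h
      have hsum : ∑ w ∈ K, coord G v w (indPoint G Q) = coord G v u (indPoint G Q) := by
        refine Finset.sum_eq_single_of_mem u hu fun w hw hwu => ?_
        rw [coord_indPoint, if_neg]
        rintro ⟨-, hQ'⟩
        exact hstable v w u (hKsub hw) (hKsub hu) hQ' hQ (hKc hw hu hwu)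
      rw [hsum]
      refine (coord_indPoint_le_one _ _ _).trans ?_
      unfold repVal
      split_ifs with hs
      · exact le_rfl
      · rw [coord_indPoint, if_pos ⟨Or.inr ⟨rfl, hs⟩, hrep v u (hKsub hu) hQ⟩]
    · push Not at h
      rw [Finset.sum_eq_zero fun w hw => ?_]
      · exact hrep0 v
      · rw [coord_indPoint, if_neg fun hc => h w hw hc.2]
  · have hv : v ∉ antiPos G v := by simp [mem_antiPos, mem_antiNeg]
    calc (p v : ℝ) * repVal G (indPoint G Q) v
          + ∑ u ∈ antiPos G v, (p u : ℝ) * coord G v u (indPoint G Q)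
        ≤ p v + ∑ u ∈ antiPos G v, (p u : ℝ) :=
          add_le_add (mul_le_of_le_one_right (by positivity) (hrep1 v))
            (Finset.sum_le_sum fun u _ =>
              mul_le_of_le_one_right (by positivity) (coord_indPoint_le_one _ _ _))
      _ = ∑ u ∈ insert v (antiPos G v), (p u : ℝ) := (Finset.sum_insert (f := fun u => (p u : ℝ)) hv).symm
      _ ≤ ∑ u, (p u : ℝ) := Finset.sum_le_sum_of_subset_of_nonneg (Finset.subset_univ _)
            fun _ _ _ => by positivity
      _ ≤ y := hy

theorem indPoint_or_eq_add {Q : V → V → Prop} {u v : V} (h : ¬ Q u v) :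
    indPoint G (fun a b => Q a b ∨ (a = u ∧ b = v)) = indPoint G Q + unitVec G u v := by
  classical
  ext e
  simp only [indPoint, unitVec, Pi.add_apply]
  by_cases he : e.1.1 = u ∧ e.1.2 = v
  · simp [he, h]
  · simp [he]

theorem unitVec_self_of_isSource {v : V} (hv : IsSource G v) : unitVec G v v = 0 := by
  classical
  ext ⟨⟨a, b⟩, hab⟩
  simp only [unitVec, indPoint, Pi.zero_apply, ite_eq_right_iff, one_ne_zero, imp_false]
  rintro ⟨rfl, rfl⟩
  rcases hab with h | h
  · exact not_isSource_of_mem h hv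
  · exact h.2 hv

open Classical in
theorem internalLHS_unitVec {U : Finset V} {a b : V} (y : ℝ)
    (hab : a ∈ antiNeg G b ∨ (a = b ∧ ¬ IsSource G b)) :
    internalLHS G U (y, unitVec G a b) =
      if b ∈ U \ sourcesIn G U ∧ (a = b ∨ a ∉ U) then 1 else 0 := by
  rw [internalLHS_apply]
  simp only [unitVec, coord_indPoint]
  by_cases hb : b ∈ U \ sourcesIn G U
  · rw [Finset.sum_eq_single_of_mem b hb]
    · by_cases ha : a ∈ insert b (antiNeg G b \ U)
      · rw [Finset.sum_eq_single_of_mem a ha]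
        · rw [if_pos ⟨hab, rfl, rfl⟩, if_pos]
          refine ⟨hb, ?_⟩
          rw [Finset.mem_insert, Finset.mem_sdiff] at ha
          exact ha.imp id And.right
        · exact fun u _ hu => if_neg fun h => hu h.2.1
      · rw [if_neg, Finset.sum_eq_zero]
        · intro u hu
          refine if_neg fun h => ha ?_
          rw [← h.2.1]
          exact hu
        · rintro ⟨-, h⟩
          refine ha ?_
          rw [Finset.mem_insert, Finset.mem_sdiff]
          rcases hab with h' | h'
          · exact h.imp id fun h => ⟨h', h⟩
          · exact Or.inl h'.1
    · exact fun v _ hv => Finset.sum_eq_zero fun u _ => if_neg fun h => hv h.2.2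
  · rw [if_neg fun h => hb h.1]
    refine Finset.sum_eq_zero fun v hv => Finset.sum_eq_zero fun u _ => if_neg fun h => hb ?_
    rw [← h.2.2]
    exact hv

theorem eq_sum_unitVec [Fintype (Var G)] (x : Var G → ℝ) : x = ∑ e : Var G, x e • unitVec G e.1.1 e.1.2 := by
  classical
  ext e
  rw [Finset.sum_apply, Finset.sum_eq_single_of_mem e (Finset.mem_univ _)]
  · simp [unitVec, indPoint]
  · intro e' _ hne
    have : ¬ (e.1.1 = e'.1.1 ∧ e.1.2 = e'.1.2) := fun h =>
      hne (Subtype.ext (Prod.ext h.1.symm h.2.symm))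
    simp [unitVec, indPoint, this]

end Points

/-- A colouring, given by the map from each vertex to the first vertex of its colour class. -/
structure IsRepMap (G : SimpleGraph V) (r : V → V) : Prop where
  mem : ∀ v, r v = v ∨ r v ∈ antiNeg G v
  idem : ∀ v, r (r v) = r v
  stable : ∀ v w, r v = r w → ¬ G.Adj v w

/-- The 0/1 point of a colouring. -/
noncomputable def mapPoint (G : SimpleGraph V) (r : V → V) : Var G → ℝ :=
  indPoint G fun u v => r v = u

theorem mapPoint_eq_sum (r : V → V) : mapPoint G r = ∑ v, unitVec G (r v) v := by
  classical
  ext e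
  rw [Finset.sum_apply, Finset.sum_eq_single_of_mem e.1.2 (Finset.mem_univ _)]
  · simp [mapPoint, unitVec, indPoint, eq_comm]
  · intro v _ hv
    simp [unitVec, indPoint, hv.symm]

theorem IsRepMap.mem_feasiblePoints {r : V → V} (hr : IsRepMap G r) {p : V → ℕ} {y : ℝ}
    (hy : ∑ v, (p v : ℝ) ≤ y) : (y, mapPoint G r) ∈ feasiblePoints G p :=
  indPoint_mem_feasiblePoints hy (fun v _ => ⟨r v, hr.mem v, rfl⟩)
    (fun v u _ h => by rw [← h, hr.idem]) (fun v u w _ _ h h' => hr.stable u w (h.trans h'.symm))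

/-- Covering is an inequality, so `v` may be covered a second time; as `u` represents only itself,
no clique constraint is violated. -/
theorem IsRepMap.add_mem_feasiblePoints {r : V → V} (hr : IsRepMap G r) {p : V → ℕ} {y : ℝ}
    (hy : ∑ v, (p v : ℝ) ≤ y) {u v : V} (hu : ∀ w, r w = u ↔ w = u) (huv : u ∈ antiNeg G v) :
    (y, mapPoint G r + unitVec G u v) ∈ feasiblePoints G p := by
  have hne : v ≠ u := (mem_antiNeg.1 huv).1.ne'
  have heq := indPoint_or_eq_add (G := G) (Q := fun a b => r b = a) (u := u) (v := v)
    fun h => hne ((hu v).1 h)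
  rw [mapPoint, ← heq]
  refine indPoint_mem_feasiblePoints hy (fun w _ => ⟨r w, hr.mem w, Or.inl rfl⟩) ?_ ?_
  · rintro a b - (h | ⟨rfl, rfl⟩)
    · left; rw [← h, hr.idem]
    · left; exact (hu a).2 rfl
  · have key : ∀ b, b ∈ antiPos G u → (r b = u ∨ (u = u ∧ b = v)) → b = v := by
      rintro b hb (h | h)
      · rw [(hu b).1 h, mem_antiPos, mem_antiNeg] at hb
        exact absurd hb.1 (lt_irrefl _)
      · exact h.2
    intro a b c hb hc h h'
    by_cases ha : a = u
    · subst ha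
      rw [key b hb h, key c hc h']
      exact G.irrefl
    · rcases h with h | h
      · rcases h' with h' | h'
        · exact hr.stable b c (h.trans h'.symm)
        · exact absurd h'.1 ha
      · exact absurd h.1 ha

theorem IsRepMap.update [DecidableEq V] {r : V → V} (hr : IsRepMap G r) {u v : V}
    (hu : ∀ w, r w = u ↔ w = u) (hv : ∀ w, r w = v ↔ w = v) (huv : u ∈ antiNeg G v) :
    IsRepMap G (Function.update r v u) := by
  have hne : u ≠ v := (mem_antiNeg.1 huv).1.ne
  have hru := (hu u).2 rfl
  refine ⟨fun w => ?_, fun w => ?_, fun w w' h => ?_⟩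
  · by_cases hw : w = v
    · subst hw; simp [huv]
    · simpa [hw] using hr.mem w
  · by_cases hw : w = v
    · subst hw; simp [hne, hru]
    · have : r w ≠ v := fun h => hw ((hv w).1 h)
      simp [hw, this, hr.idem]
  · by_cases hw : w = v <;> by_cases hw' : w' = v
    · rw [hw, hw']; exact G.irrefl
    · simp only [hw, Function.update_self, Function.update_of_ne hw'] at h
      rw [hw, (hu w').1 h.symm]
      exact fun h => (mem_antiNeg.1 huv).2 h.symm
    · simp only [hw', Function.update_self, Function.update_of_ne hw] at h
      rw [hw', (hu w).1 h]
      exact (mem_antiNeg.1 huv).2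
    · simp only [Function.update_of_ne hw', Function.update_of_ne hw] at h
      exact hr.stable w w' h

theorem mapPoint_update [DecidableEq V] {r : V → V} {u v : V} (hv : r v = v) :
    mapPoint G (Function.update r v u) + unitVec G v v = mapPoint G r + unitVec G u v := by
  rw [mapPoint_eq_sum, mapPoint_eq_sum, ← Finset.add_sum_erase _ _ (Finset.mem_univ v),
    ← Finset.add_sum_erase (a := v) _ (fun w => unitVec G (r w) w) (Finset.mem_univ v),
    Function.update_self, hv]
  have : ∑ x ∈ Finset.univ.erase v, unitVec G (Function.update r v u x) x =
      ∑ x ∈ Finset.univ.erase v, unitVec G (r x) x :=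
    Finset.sum_congr rfl fun x hx => by rw [Function.update_of_ne (Finset.ne_of_mem_erase hx)]
  rw [this]
  abel

/-! ### First vertices of colour classes -/

section ColoringMap

variable {U : Finset V} (C : ↥(U : Set V) → ℕ)

omit [Fintype V] in
theorem exists_first (v : (U : Set V)) :
    ∃ w : (U : Set V), C w = C v ∧ ∀ w', C w' = C v → w ≤ w' := by
  classical
  obtain ⟨w, hw, hmin⟩ := Finset.exists_min_image
    ((Finset.univ : Finset (U : Set V)).filter fun w => C w = C v) id ⟨v, by simp⟩
  exact ⟨w, by simpa using hw, fun w' hw' => hmin w' (by simpa using hw')⟩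

open Classical in
/-- The map from a vertex of `U` to the first vertex of its colour class; the vertices outside
`U` are classes of their own. -/
noncomputable def firstMap (v : V) : V :=
  if hv : v ∈ (U : Set V) then (exists_first C ⟨v, hv⟩).choose else v

theorem firstMap_of_notMem {v : V} (hv : v ∉ U) : firstMap C v = v := by
  rw [firstMap, dif_neg (by simpa using hv)]

theorem firstMap_mem {v : V} (hv : v ∈ U) : firstMap C v ∈ U := by
  rw [firstMap, dif_pos (by simpa using hv)]
  exact (exists_first C ⟨v, hv⟩).choose.2

theorem color_firstMap (v : (U : Set V)) (hv : firstMap C v ∈ (U : Set V)) :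
    C ⟨firstMap C v, hv⟩ = C v := by
  have h : firstMap C v = (exists_first C v).choose := by rw [firstMap, dif_pos v.2]
  have h' : (⟨firstMap C v, hv⟩ : (U : Set V)) = (exists_first C v).choose := Subtype.ext h
  rw [h']
  exact (exists_first C v).choose_spec.1

theorem firstMap_le (v w : (U : Set V)) (h : C w = C v) : firstMap C v ≤ w := by
  rw [firstMap, dif_pos v.2]
  exact (exists_first C v).choose_spec.2 w h

theorem firstMap_eq_iff (v w : (U : Set V)) : firstMap C v = firstMap C w ↔ C v = C w := by
  have hv := firstMap_mem C v.2
  have hw := firstMap_mem C w.2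
  constructor
  · intro h
    rw [← color_firstMap C v hv, ← color_firstMap C w hw]
    congr 1
    exact Subtype.ext h
  · intro h
    apply le_antisymm
    · exact firstMap_le C v ⟨_, hw⟩ ((color_firstMap C w hw).trans h.symm)
    · exact firstMap_le C w ⟨_, hv⟩ ((color_firstMap C v hv).trans h)

theorem firstMap_eq_self_iff (v : (U : Set V)) :
    firstMap C v = v ↔ ∀ w, C w = C v → v ≤ w := by
  constructor
  · intro h w hw
    have := firstMap_le C v w hw
    rwa [h] at this
  · intro h
    have hv := firstMap_mem C v.2
    exact le_antisymm (firstMap_le C v v rfl) (h ⟨_, hv⟩ (color_firstMap C v hv))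

variable {C}

theorem isRepMap_firstMap (hC : ∀ u v, C u = C v → ¬ (G.induce (U : Set V)).Adj u v) :
    IsRepMap G (firstMap C) := by
  refine ⟨fun v => ?_, fun v => ?_, fun v w h => ?_⟩
  · by_cases hv : v ∈ U
    · rw [or_iff_not_imp_left]
      intro hne
      rw [mem_antiNeg]
      refine ⟨lt_of_le_of_ne (firstMap_le C ⟨v, hv⟩ ⟨v, hv⟩ rfl) hne, ?_⟩
      exact hC ⟨_, firstMap_mem C hv⟩ ⟨v, hv⟩ (color_firstMap C ⟨v, hv⟩ _)
    · exact Or.inl (firstMap_of_notMem C hv)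
  · by_cases hv : v ∈ U
    · exact (firstMap_eq_iff C ⟨_, firstMap_mem C hv⟩ ⟨v, hv⟩).2 (color_firstMap C ⟨v, hv⟩ _)
    · rw [firstMap_of_notMem C hv, firstMap_of_notMem C hv]
  · by_cases hv : v ∈ U <;> by_cases hw : w ∈ U
    · exact hC ⟨v, hv⟩ ⟨w, hw⟩ ((firstMap_eq_iff C ⟨v, hv⟩ ⟨w, hw⟩).1 h)
    · rw [firstMap_of_notMem C hw] at h
      exact absurd (h ▸ firstMap_mem C hv) hw
    · rw [firstMap_of_notMem C hv] at h
      exact absurd (h ▸ firstMap_mem C hw) hv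
    · rw [firstMap_of_notMem C hv, firstMap_of_notMem C hw] at h
      rw [h]
      exact G.irrefl

theorem firstMap_eq_iff_of_singleton {u : V} (hu : ∀ hu : u ∈ (U : Set V),
    ∀ w, C w = C ⟨u, hu⟩ → w = ⟨u, hu⟩) (w : V) : firstMap C w = u ↔ w = u := by
  by_cases huU : u ∈ U
  · have key : firstMap C u = u := (firstMap_eq_self_iff C ⟨u, huU⟩).2 fun w hw =>
      (hu huU w hw).ge
    constructor
    · intro h
      by_cases hw : w ∈ U
      · have := (firstMap_eq_iff C ⟨w, hw⟩ ⟨u, huU⟩).1 (h.trans key.symm)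
        exact congrArg Subtype.val (hu huU _ this)
      · rwa [firstMap_of_notMem C hw] at h
    · rintro rfl
      exact key
  · constructor
    · intro h
      by_cases hw : w ∈ U
      · exact absurd (h ▸ firstMap_mem C hw) huU
      · rwa [firstMap_of_notMem C hw] at h
    · rintro rfl
      exact firstMap_of_notMem C huU

/-- The left-hand side counts the class minima in `U` that are not sources of `U`. Every source of
`U` is a class minimum, and there are at most `n` classes. -/
theorem internalLHS_firstMap_le {n : ℕ} (hn : ∀ v, C v < n)
    (hC : ∀ u v, C u = C v → ¬ (G.induce (U : Set V)).Adj u v) (y : ℝ) :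
    internalLHS G U (y, mapPoint G (firstMap C)) ≤ (n : ℝ) - ((sourcesIn G U).card : ℝ) := by
  classical
  have hr := isRepMap_firstMap hC
  have hval : internalLHS G U (y, mapPoint G (firstMap C)) =
      (((U \ sourcesIn G U).filter fun v => firstMap C v = v).card : ℝ) := by
    rw [internalLHS_apply, Finset.card_eq_sum_ones, Nat.cast_sum, Finset.sum_filter]
    refine Finset.sum_congr rfl fun v hv => ?_
    have hvU := (Finset.mem_sdiff.1 hv).1
    obtain ⟨-, u₀, -, hu₀⟩ := mem_sdiff_sourcesIn.1 hv
    have hmem := firstMap_mem C hvU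
    simp only [mapPoint, coord_indPoint]
    rw [Finset.sum_insert (by simp [hvU]), Finset.sum_eq_zero, add_zero]
    · simp [not_isSource_of_mem hu₀]
    · intro u hu
      refine if_neg fun h => (Finset.mem_sdiff.1 hu).2 ?_
      rw [← h.2]
      exact hmem
  have hS : ∀ v ∈ sourcesIn G U, firstMap C v = v := by
    intro v hv
    rw [mem_sourcesIn] at hv
    exact (hr.mem v).resolve_right (hv.2 _ (firstMap_mem C hv.1))
  have hcard : ((U \ sourcesIn G U).filter fun v => firstMap C v = v).card +
      (sourcesIn G U).card = (U.filter fun v => firstMap C v = v).card := by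
    rw [← Finset.card_union_of_disjoint]
    · congr 1
      ext v
      have := hS v
      have hsub : v ∈ sourcesIn G U → v ∈ U := fun h => (mem_sourcesIn.1 h).1
      simp only [Finset.mem_union, Finset.mem_filter, Finset.mem_sdiff]
      tauto
    · rw [Finset.disjoint_left]
      intro v hv hv'
      exact (Finset.mem_sdiff.1 (Finset.mem_filter.1 hv).1).2 hv'
  have hle : (U.filter fun v => firstMap C v = v).card ≤ n := by
    have := Finset.card_le_card_of_injOn (s := U.filter fun v => firstMap C v = v)
      (t := Finset.range n) (fun v => if hv : v ∈ (U : Set V) then C ⟨v, hv⟩ else 0)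
      (fun v hv => by
        have hvU : v ∈ (U : Set V) := (Finset.mem_filter.1 hv).1
        simp only [dif_pos hvU, Finset.coe_range, Set.mem_Iio]
        exact hn _)
      (fun v hv w hw hvw => by
        have hvU : v ∈ (U : Set V) := (Finset.mem_filter.1 hv).1
        have hwU : w ∈ (U : Set V) := (Finset.mem_filter.1 hw).1
        simp only [dif_pos hvU, dif_pos hwU] at hvw
        rw [← (Finset.mem_filter.1 hv).2, ← (Finset.mem_filter.1 hw).2]
        exact (firstMap_eq_iff C ⟨v, hvU⟩ ⟨w, hwU⟩).2 hvw)
    simpa using this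
  have h1 : (((U \ sourcesIn G U).filter fun v => firstMap C v = v).card : ℝ) +
      (sourcesIn G U).card ≤ n := by exact_mod_cast hcard.trans_le hle
  rw [hval]
  linarith

end ColoringMap

end RepForm

/-! ### The facet criterion and the coefficients of the functional -/

/-- A valid inequality defines a facet if every linear map which is constant on a nonempty set of
tight points is a multiple of its left-hand side, and some point is not tight. -/
theorem isFacetDefining_of_linearMap {E : Type*} [AddCommGroup E] [Module ℝ E]
    [FiniteDimensional ℝ E] {P T : Set E} {f : E →ₗ[ℝ] ℝ} {b : ℝ} (hvalid : ∀ z ∈ P, b ≤ f z)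
    (hT : T ⊆ {z | z ∈ P ∧ f z = b}) (hne : T.Nonempty) (hex : ∃ z ∈ P, f z ≠ b)
    (hmul : ∀ (W : Submodule ℝ E) (k : E ⧸ W), (∀ z ∈ T, W.mkQ z = k) →
      ∃ τ, ∀ z, W.mkQ z = f z • τ) :
    IsFacetDefining P f b := by
  set F := {z | z ∈ P ∧ f z = b} with hF
  obtain ⟨z₀, hz₀⟩ := hne
  obtain ⟨z₁, hz₁, hne₁⟩ := hex
  have hz₀F := hT hz₀
  refine ⟨hvalid, ⟨z₀, hz₀F⟩, ?_⟩
  have hker : (affineSpan ℝ F).direction = LinearMap.ker f := by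
    apply le_antisymm
    · rw [direction_affineSpan, vectorSpan_def, Submodule.span_le]
      rintro _ ⟨a, ha, c, hc, rfl⟩
      simp only [SetLike.mem_coe, LinearMap.mem_ker, vsub_eq_sub, map_sub]
      rw [ha.2, hc.2, sub_self]
    · intro z hz
      -- Quotienting by the direction of the face itself gives a map constant on `T`; being a
      -- multiple of `f`, it kills `ker f`.
      obtain ⟨τ, hτ⟩ := hmul (affineSpan ℝ F).direction (Submodule.mkQ _ z₀) fun z hz => by
        rw [Submodule.mkQ_apply, Submodule.mkQ_apply, Submodule.Quotient.eq]
        exact AffineSubspace.vsub_mem_direction (mem_affineSpan ℝ (hT hz))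
          (mem_affineSpan ℝ hz₀F)
      have := hτ z
      rw [LinearMap.mem_ker.1 hz, zero_smul, Submodule.mkQ_apply] at this
      exact (Submodule.Quotient.mk_eq_zero _).1 this
  set w := z₁ - z₀ with hw
  have hfw : f w ≠ 0 := by
    rw [hw, map_sub, hz₀F.2]
    exact sub_ne_zero.2 hne₁
  have htop : (affineSpan ℝ P).direction = ⊤ := by
    rw [eq_top_iff]
    intro z _
    have hle : (affineSpan ℝ F).direction ≤ (affineSpan ℝ P).direction :=
      AffineSubspace.direction_le (affineSpan_mono ℝ fun z hz => hz.1)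
    have h1 : z - (f z / f w) • w ∈ (affineSpan ℝ P).direction := by
      apply hle
      rw [hker, LinearMap.mem_ker, map_sub, map_smul, smul_eq_mul, div_mul_cancel₀ _ hfw, sub_self]
    have h2 : w ∈ (affineSpan ℝ P).direction :=
      AffineSubspace.vsub_mem_direction (mem_affineSpan ℝ hz₁) (mem_affineSpan ℝ hz₀F.1)
    have := Submodule.add_mem _ h1 (Submodule.smul_mem _ (f z / f w) h2)
    rwa [sub_add_cancel] at this
  rw [hker, htop, finrank_top]
  exact Module.Dual.finrank_ker_add_one_of_ne_zero (f := f) fun h => hfw (by rw [h]; rfl)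

namespace RepForm

variable {V : Type*} [Fintype V] [LinearOrder V] {G : SimpleGraph V} {p : V → ℕ} {U : Finset V}
  {n : ℕ}

theorem internalLHS_firstMap (hn : (G.induce (U : Set V)).chromaticNumber = n)
    {C : ↥(U : Set V) → ℕ} (hlt : ∀ v, C v < n)
    (hC : ∀ u v, C u = C v → ¬ (G.induce (U : Set V)).Adj u v) (y : ℝ) :
    internalLHS G U (y, mapPoint G (firstMap C)) = (n : ℝ) - ((sourcesIn G U).card : ℝ) := by
  refine le_antisymm (internalLHS_firstMap_le hlt hC y) ?_
  -- The left-hand side ignores `y`, so the lower bound may be taken from the instance with zero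
  -- processing times and `y = 0`.
  have h1 := le_internalLHS ((isRepMap_firstMap hC).mem_feasiblePoints
    (p := fun _ => 0) (y := 0) (by simp)) hn
  rw [internalLHS_apply] at h1 ⊢
  exact h1

theorem internalLHS_snd (y y' : ℝ) (x : Var G → ℝ) :
    internalLHS G U (y, x) = internalLHS G U (y', x) := by
  rw [internalLHS_apply, internalLHS_apply]

/-- For every vertex `u` there is a tight colouring in which `u` is a class of its own. -/
theorem exists_tight_map (hcrit : IsChiCritical (G.induce (U : Set V)))
    (hn : (G.induce (U : Set V)).chromaticNumber = n) (hU : U.Nonempty) (u : V) :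
    ∃ r, IsRepMap G r ∧ (∀ w, r w = u ↔ w = u) ∧ (∀ w ∉ U, ∀ v, r v = w ↔ v = w) ∧
      ∀ y, internalLHS G U (y, mapPoint G r) = (n : ℝ) - ((sourcesIn G U).card : ℝ) := by
  have out : ∀ {C : ↥(U : Set V) → ℕ}, ∀ w ∉ U, ∀ v, firstMap C v = w ↔ v = w :=
    fun w hw v => firstMap_eq_iff_of_singleton (fun h => absurd h hw) v
  by_cases hu : u ∈ U
  · obtain ⟨C, hlt, hC, hs⟩ := hcrit.exists_coloring hn ⟨u, hu⟩
    exact ⟨firstMap C, isRepMap_firstMap hC, firstMap_eq_iff_of_singleton fun _ => hs, out,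
      internalLHS_firstMap hn hlt hC⟩
  · obtain ⟨u', hu'⟩ := hU
    obtain ⟨C, hlt, hC, -⟩ := hcrit.exists_coloring hn ⟨u', hu'⟩
    exact ⟨firstMap C, isRepMap_firstMap hC, out u hu, out, internalLHS_firstMap hn hlt hC⟩

section Functional

variable {A : Type*} [AddCommGroup A] [Module ℝ A] {φ : (ℝ × (Var G → ℝ)) →ₗ[ℝ] A} {k : A}
  (hφ : ∀ z ∈ feasiblePoints G p,
    internalLHS G U z = (n : ℝ) - ((sourcesIn G U).card : ℝ) → φ z = k)
  (hcrit : IsChiCritical (G.induce (U : Set V)))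
  (hn : (G.induce (U : Set V)).chromaticNumber = n) (hU : U.Nonempty)

include hφ

/-- Moving `v` from its own class into that of `u` trades `x_{vv}` for `x_{uv}`. The hypothesis `h`
gives both variables the same coefficient in the inequality, so the new point is tight too. -/
theorem functional_swap {r : V → V} (hr : IsRepMap G r)
    (ht : ∀ y, internalLHS G U (y, mapPoint G r) = (n : ℝ) - ((sourcesIn G U).card : ℝ))
    {u v : V} (hu : ∀ w, r w = u ↔ w = u) (hv : ∀ w, r w = v ↔ w = v) (huv : u ∈ antiNeg G v)
    (h : v ∈ U \ sourcesIn G U → u ∉ U) : φ (0, unitVec G v v) = φ (0, unitVec G u v) := by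
  classical
  have h1 := hφ _ (hr.mem_feasiblePoints le_rfl) (ht _)
  have h3 : (∑ v, (p v : ℝ), mapPoint G (Function.update r v u)) + ((0 : ℝ), unitVec G v v) =
      (∑ v, (p v : ℝ), mapPoint G r) + ((0 : ℝ), unitVec G u v) := by
    rw [Prod.mk_add_mk, Prod.mk_add_mk, mapPoint_update ((hv v).2 rfl)]
  have h4 : internalLHS G U ((0 : ℝ), unitVec G v v) =
      internalLHS G U ((0 : ℝ), unitVec G u v) := by
    rw [internalLHS_unitVec _ (Or.inr ⟨rfl, not_isSource_of_mem huv⟩),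
      internalLHS_unitVec _ (Or.inl huv)]
    have := (mem_antiNeg.1 huv).1.ne
    congr 1
    simp only [eq_iff_iff]
    tauto
  have h5 := congrArg (internalLHS G U) h3
  rw [map_add, map_add, h4, ht] at h5
  have h2 := hφ _ ((hr.update hu hv huv).mem_feasiblePoints le_rfl) (add_right_cancel h5)
  have h6 := congrArg φ h3
  rw [map_add, map_add, h1, h2] at h6
  exact add_left_cancel h6

include hcrit hn hU

theorem functional_fst : φ (1, 0) = 0 := by
  obtain ⟨u, hu⟩ := hU
  obtain ⟨r, hr, -, -, ht⟩ := exists_tight_map hcrit hn ⟨u, hu⟩ u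
  have h1 := hφ _ (hr.mem_feasiblePoints le_rfl) (ht _)
  have h2 := hφ _ (hr.mem_feasiblePoints (le_add_of_nonneg_right zero_le_one)) (ht _)
  have h3 : ((∑ v, (p v : ℝ)) + 1, mapPoint G r) =
      (∑ v, (p v : ℝ), mapPoint G r) + ((1 : ℝ), (0 : Var G → ℝ)) := by simp
  rw [h3, map_add, h1] at h2
  simpa using h2

/-- Here `x_{uv}` does not occur in the inequality, so covering `v` additionally by a singleton `u`
preserves tightness. -/
theorem functional_unitVec_eq_zero {u v : V} (huv : u ∈ antiNeg G v)
    (h : ¬ (v ∈ U \ sourcesIn G U ∧ u ∉ U)) : φ (0, unitVec G u v) = 0 := by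
  obtain ⟨r, hr, hru, -, ht⟩ := exists_tight_map hcrit hn hU u
  have h1 := hφ _ (hr.mem_feasiblePoints le_rfl) (ht _)
  have h3 : (∑ v, (p v : ℝ), mapPoint G r + unitVec G u v) =
      (∑ v, (p v : ℝ), mapPoint G r) + ((0 : ℝ), unitVec G u v) := by simp
  have h2 := hφ _ (hr.add_mem_feasiblePoints le_rfl hru huv) (by
    rw [h3, map_add, ht, internalLHS_unitVec _ (Or.inl huv), if_neg, add_zero]
    have := (mem_antiNeg.1 huv).1.ne
    tauto)
  rw [h3, map_add, h1] at h2
  simpa using h2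

/-- For a source the variable does not exist. Otherwise swap it with some `x_{uv}`, whose image is
already known to vanish. -/
theorem functional_unitVec_self_eq_zero {v : V} (hv : v ∉ U \ sourcesIn G U) :
    φ (0, unitVec G v v) = 0 := by
  by_cases hs : IsSource G v
  · rw [unitVec_self_of_isSource hs]
    exact map_zero φ
  obtain ⟨u, hu⟩ : (antiNeg G v).Nonempty := Finset.nonempty_iff_ne_empty.2 hs
  rw [← functional_unitVec_eq_zero hφ hcrit hn hU hu fun h => hv h.1]
  by_cases hvU : v ∈ U
  · obtain ⟨r, hr, hrv, hout, ht⟩ := exists_tight_map hcrit hn hU v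
    have huU : u ∉ U := fun h => hv (mem_sdiff_sourcesIn.2 ⟨hvU, u, h, hu⟩)
    exact functional_swap hφ hr ht (hout u huU) hrv hu fun h => absurd h hv
  · obtain ⟨r, hr, hru, hout, ht⟩ := exists_tight_map hcrit hn hU u
    exact functional_swap hφ hr ht hru (hout v hvU) hu fun h => absurd h hv

theorem functional_unitVec_eq_self {u v : V} (huv : u ∈ antiNeg G v) (hu : u ∉ U) :
    φ (0, unitVec G v v) = φ (0, unitVec G u v) := by
  obtain ⟨r, hr, hrv, hout, ht⟩ := exists_tight_map hcrit hn hU v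
  exact functional_swap hφ hr ht (hout u hu) hrv huv fun _ => hu

/-- At a tight colouring only the variables `x_{vv}` of class minima in `U` survive under `φ`; the
remaining constant is the contribution of `y`. -/
theorem functional_isClassMinSum : ∃ K, IsClassMinSum (G.induce (U : Set V)) n
    (fun v => φ (0, unitVec G (v : V) v)) K := by
  classical
  refine ⟨k - φ (∑ v, (p v : ℝ), 0), fun C hlt hC => ?_⟩
  have hr := isRepMap_firstMap hC
  have h1 := hφ _ (hr.mem_feasiblePoints le_rfl) (internalLHS_firstMap hn hlt hC _)
  have h2 : φ (∑ v, (p v : ℝ), mapPoint G (firstMap C)) =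
      φ (∑ v, (p v : ℝ), 0) + ∑ v, φ (0, unitVec G (firstMap C v) v) := by
    have h3 := map_sum (φ.comp (LinearMap.inr ℝ ℝ (Var G → ℝ)))
      (fun v => unitVec G (firstMap C v) v) Finset.univ
    simp only [LinearMap.comp_apply, LinearMap.inr_apply] at h3
    rw [← h3, ← mapPoint_eq_sum, ← map_add, Prod.mk_add_mk, add_zero, zero_add]
  rw [h1] at h2
  rw [h2, add_sub_cancel_left, Finset.sum_filter]
  have h4 : ∀ v, φ (0, unitVec G (firstMap C v) v) =
      if v ∈ U then (if firstMap C v = v then φ (0, unitVec G v v) else 0) else 0 := by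
    intro v
    by_cases hvU : v ∈ U
    · rw [if_pos hvU]
      split_ifs with hv
      · rw [hv]
      · exact functional_unitVec_eq_zero hφ hcrit hn hU ((hr.mem v).resolve_left hv)
          fun h => h.2 (firstMap_mem C hvU)
    · rw [if_neg hvU, firstMap_of_notMem C hvU]
      exact functional_unitVec_self_eq_zero hφ hcrit hn hU
        fun h => hvU (Finset.mem_sdiff.1 h).1
  rw [Finset.sum_congr rfl fun v _ => h4 v, Finset.sum_ite_mem, Finset.univ_inter,
    Finset.sum_subtype U (p := fun v => v ∈ (U : Set V)) fun v => Iff.rfl]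
  refine Finset.sum_congr rfl fun v _ => ?_
  simp only [firstMap_eq_self_iff C v]

theorem functional_eq_smul
    (hweb : IsWeb (G.induce (U : Set V)) ∨ IsAntiweb (G.induce (U : Set V))) :
    ∃ τ, ∀ z, φ z = internalLHS G U z • τ := by
  classical
  obtain ⟨K, hK⟩ := functional_isClassMinSum hφ hcrit hn hU
  obtain ⟨α, m, pos, harr, hnm, -⟩ := hcrit.exists_arrangement hweb hn
  have hconst : ∃ τ, ∀ v ∈ U \ sourcesIn G U, φ (0, unitVec G v v) = τ := by
    by_cases hne : (U \ sourcesIn G U).Nonempty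
    · obtain ⟨w, hw⟩ := hne
      refine ⟨φ (0, unitVec G w w), fun v hv => ?_⟩
      obtain ⟨hvU, u, huU, hu⟩ := mem_sdiff_sourcesIn.1 hv
      obtain ⟨hwU, u', huU', hu'⟩ := mem_sdiff_sourcesIn.1 hw
      rw [mem_antiNeg] at hu hu'
      exact harr.eq_of_not_source hnm hK (u := ⟨u, huU⟩) (v := ⟨v, hvU⟩) (u' := ⟨u', huU'⟩)
        (v' := ⟨w, hwU⟩) hu.1 hu.2 hu'.1 hu'.2
    · exact ⟨0, fun v hv => absurd ⟨v, hv⟩ hne⟩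
  obtain ⟨τ, hτ⟩ := hconst
  have hunit : ∀ e : Var G, φ (0, unitVec G e.1.1 e.1.2) =
      internalLHS G U (0, unitVec G e.1.1 e.1.2) • τ := by
    rintro ⟨⟨u, v⟩, huv⟩
    change φ (0, unitVec G u v) = internalLHS G U (0, unitVec G u v) • τ
    change u ∈ antiNeg G v ∨ (u = v ∧ ¬ IsSource G v) at huv
    rw [internalLHS_unitVec _ huv]
    by_cases hv : v ∈ U \ sourcesIn G U
    · rcases huv with huv | ⟨rfl, hs⟩
      · by_cases hu : u ∈ U
        · have := (mem_antiNeg.1 huv).1.ne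
          rw [if_neg (by tauto), zero_smul]
          exact functional_unitVec_eq_zero hφ hcrit hn hU huv fun h => h.2 hu
        · rw [if_pos ⟨hv, Or.inr hu⟩, one_smul, ← hτ v hv]
          exact (functional_unitVec_eq_self hφ hcrit hn hU huv hu).symm
      · rw [if_pos ⟨hv, Or.inl rfl⟩, one_smul, hτ u hv]
    · rw [if_neg fun h => hv h.1, zero_smul]
      rcases huv with huv | ⟨rfl, hs⟩
      · exact functional_unitVec_eq_zero hφ hcrit hn hU huv fun h => hv h.1
      · exact functional_unitVec_self_eq_zero hφ hcrit hn hU hv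
  refine ⟨τ, fun z => ?_⟩
  have key : φ = (internalLHS G U).smulRight τ := by
    refine LinearMap.prod_ext (LinearMap.ext_ring ?_) (LinearMap.ext fun x => ?_)
    · have h0 : internalLHS G U ((1 : ℝ), (0 : Var G → ℝ)) = 0 := by
        rw [internalLHS_snd 1 0]
        exact map_zero _
      simp only [LinearMap.comp_apply, LinearMap.inl_apply, LinearMap.smulRight_apply, h0,
        zero_smul]
      exact functional_fst hφ hcrit hn hU
    · rw [eq_sum_unitVec x, map_sum, map_sum]
      refine Finset.sum_congr rfl fun e _ => ?_
      rw [map_smul, map_smul]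
      congr 1
      exact hunit e
  rw [key, LinearMap.smulRight_apply]

end Functional

theorem internalLHS_mapPoint_id (y : ℝ) :
    internalLHS G U (y, mapPoint G id) = ((U \ sourcesIn G U).card : ℝ) := by
  classical
  rw [internalLHS_apply, Finset.card_eq_sum_ones, Nat.cast_sum]
  refine Finset.sum_congr rfl fun v hv => ?_
  obtain ⟨hvU, u₀, -, hu₀⟩ := mem_sdiff_sourcesIn.1 hv
  simp only [mapPoint, coord_indPoint]
  rw [Finset.sum_insert (by simp [hvU]), Finset.sum_eq_zero, add_zero]
  · simp [not_isSource_of_mem hu₀]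
  · intro u hu
    refine if_neg fun h => (Finset.mem_sdiff.1 hu).2 ?_
    rw [← h.2]
    exact hvU

theorem isRepMap_id : IsRepMap G id :=
  ⟨fun _ => Or.inl rfl, fun _ => rfl, fun v w h => by
    rw [show v = w from h]
    exact G.irrefl⟩

/-- The subgraph-induced inequality of a critical web or antiweb defines a facet. -/
theorem isFacetDefining_internalLHS (p : V → ℕ)
    (hcrit : IsChiCritical (G.induce (U : Set V)))
    (hweb : IsWeb (G.induce (U : Set V)) ∨ IsAntiweb (G.induce (U : Set V))) :
    IsFacetDefining (polytope G p) (internalLHS G U)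
      (((G.induce (U : Set V)).chromaticNumber.toNat : ℝ) - ((sourcesIn G U).card : ℝ)) := by
  classical
  obtain ⟨n, hn⟩ : ∃ n : ℕ, (G.induce (U : Set V)).chromaticNumber = n := by
    obtain ⟨n, hn⟩ := ENat.ne_top_iff_exists.1
      (SimpleGraph.chromaticNumber_ne_top_iff_exists.2
        ⟨_, SimpleGraph.colorable_of_fintype (G.induce (U : Set V))⟩)
    exact ⟨n, hn.symm⟩
  rw [hn, ENat.toNat_natCast]
  obtain ⟨α, m, pos, harr, hnm, hcard⟩ := hcrit.exists_arrangement hweb hn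
  have hα := harr.two_le_width
  have hm := harr.two_le_count
  have hnU : n < U.card := by
    have h1 : Fintype.card (U : Set V) = U.card := Fintype.card_coe U
    rw [h1] at hcard
    have : m < α * m := by nlinarith
    lia
  have hU : U.Nonempty := Finset.card_pos.1 (by lia)
  refine isFacetDefining_of_linearMap
    (T := {z | z ∈ feasiblePoints G p ∧ internalLHS G U z = n - (sourcesIn G U).card})
    (fun z hz => ?_) (fun z hz => ⟨subset_convexHull ℝ _ hz.1, hz.2⟩) ?_ ?_ fun W k hk => ?_
  · exact convexHull_min (fun z hz => le_internalLHS hz hn)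
      (convex_halfSpace_ge (internalLHS G U).isLinear _) hz
  · obtain ⟨u, hu⟩ := hU
    obtain ⟨r, hr, -, -, ht⟩ := exists_tight_map hcrit hn ⟨u, hu⟩ u
    exact ⟨_, hr.mem_feasiblePoints le_rfl, ht _⟩
  -- The colouring with only singleton classes is not tight, because `n = m + 1 < α * m + 1 = |U|`.
  · refine ⟨_, subset_convexHull ℝ _ (isRepMap_id.mem_feasiblePoints le_rfl), ?_⟩
    rw [internalLHS_mapPoint_id]
    have hsub : sourcesIn G U ⊆ U := fun v hv => (mem_sourcesIn.1 hv).1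
    rw [Finset.card_sdiff_of_subset hsub, Nat.cast_sub (Finset.card_le_card hsub)]
    have : (n : ℝ) < U.card := by exact_mod_cast hnU
    intro h
    linarith
  · exact functional_eq_smul (fun z hz hzt => hk z ⟨hz, hzt⟩) hcrit hn hU hweb

end RepForm

theorem mainTheorem5 {V : Type*} [Fintype V] [LinearOrder V] (G : SimpleGraph V)
    (p : V → ℕ) (hp : ∀ v, 0 < p v) (U : Finset V)
    (hcrit : IsChiCritical (G.induce (U : Set V)))
    (hweb : IsWeb (G.induce (U : Set V)) ∨ IsAntiweb (G.induce (U : Set V))) :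
    IsFacetDefining (RepForm.polytope G p) (RepForm.internalLHS G U)
      (((G.induce (U : Set V)).chromaticNumber.toNat : ℝ) -
        ((RepForm.sourcesIn G U).card : ℝ)) :=
  RepForm.isFacetDefining_internalLHS p hcrit hweb
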